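/- Let $\mathrm{dist}_{\mathcal H}(p,q)=\operatorname{acosh}\bigl(1+2\frac{\|p-q\|^2}{(1-\|p\|^2)(1-\|q\|^2)}\bigr)$ be the Poincaré metric on the unit disk, and let a point with native polar coordinates $(\phi,r)$ be mapped to the point of the disk with polar coordinates $(\phi,g(r))$, $g(r)=\sqrt{(\cosh r-1)/(\cosh r+1)}$. For $R,\alpha>0$ the random hyperbolic graph on $n$ vertices is obtained by drawing for every vertex, independently, an angle $\phi$ uniformly from $[0,2\pi)$ and a radius $r\in[0,R)$ with density $\alpha\sinh(\alpha r)/(\cosh(\alpha R)-1)$, and joining two different vertices iff their hyperbolic distance is below $R$; let $m$ be its number of edges. Consider the following generator with input $n$, an average degree $\overline k$ and $\alpha>0$. (1) It determines $R>0$ by a binary search, started on an interval $[\mathrm{lo},\mathrm{hi}]$ with $0\le \mathrm{lo}<\mathrm{hi}$ and stopped at a given tolerance or after at most $n$ halvings, for $$\overline k=\tfrac2\pi\xi^2 n\Bigl(e^{-R/2}+e^{-\alpha R}\bigl(\alpha\tfrac R2\bigl(\tfrac\pi4\tfrac1{\alpha^2}-(\pi-1)\tfrac1\alpha+(\pi-2)\bigr)-1\bigr)\Bigr),\qquad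 \xi=\frac{\alpha}{\alpha-1/2}$$ (at $\alpha=1/2$, where $\xi$ is undefined, set $\xi=0$). (2) It draws the $n$ positions as above and inserts them one by one, at $(\phi,g(r))$, into a polar quadtree with fixed leaf capacity $c\ge1$ whose root is responsible for $[0,2\pi)\times[0,g(R))$. When a point is to be inserted into a full leaf, the leaf is split into four children at $\mathrm{mid}_\phi=(\min_\phi+\max_\phi)/2$ and at the native radius $\mathrm{mid}_r=\operatorname{acosh}\bigl((\cosh(\alpha\max_r)+\cosh(\alpha\min_r))/2\bigr)/\alpha$, and its points move to the children. (3) For every vertex $v$ with disk radius $\rho=g(r[v])$, it performs a range query in the quadtree for the Euclidean circle with center $\bigl(\phi[v],\frac{2\rho}{ab+2}\bigr)$ and radius $\sqrt{\bigl(\frac{2\rho}{ab+2}\bigr)^2-\frac{2\rho^2-ab}{ab+2}}$, where $a=\cosh R-1$ and $b=1-\rho^2$. The query starts at the root and descends only into cells that meet the interior of the circle. An edge $(v,w)$ is output for every vertex $w\ne v$ found inside the circle. Arithmetic operations, comparisons, elementary functions, pointer operations and random draws cost $O(1)$ each. **Theorem.** For every leaf capacity $c\ge1$ there are constants $C$ and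 $n_0$, depending only on $c$, such that for all $n\ge n_0$, all $\overline k\in\mathbb R$, all $\alpha>0$ and all search parameters as above, with probability at least $1-1/n$ the generator terminates, outputs exactly the random hyperbolic graph of the drawn positions, and takes at most $C\,(n^{3/2}+m)\log n$ steps. -/

import Mathlib

open MeasureTheory

noncomputable section

namespace RHG

/-! Random hyperbolic graphs -/

/-- Radial coordinate in the Poincaré disk of a point at hyperbolic distance `r` from the origin. -/
def mapToPoincare (r : ℝ) : ℝ := √((Real.cosh r - 1) / (Real.cosh r + 1))

/-- The point of the Poincaré disk with native polar coordinates `(φ, r)`, as a complex number. -/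
def toDisk (p : ℝ × ℝ) : ℂ := (mapToPoincare p.2 : ℂ) * Complex.exp (p.1 * Complex.I)

/-- The Poincaré metric on the unit disk. -/
def hypDist (p q : ℂ) : ℝ :=
  Real.arcosh (1 + 2 * (‖p - q‖ ^ 2 / ((1 - ‖p‖ ^ 2) * (1 - ‖q‖ ^ 2))))

/-- Two different vertices are adjacent iff their hyperbolic distance is below `R`;
`x v = (φ[v], r[v])` is the position of `v` in native polar coordinates. -/
def hyperbolicGraph {n : ℕ} (R : ℝ) (x : Fin n → ℝ × ℝ) : SimpleGraph (Fin n) where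
  Adj v w := v ≠ w ∧ hypDist (toDisk (x v)) (toDisk (x w)) < R
  symm := ⟨fun v w h => ⟨h.1.symm, by
    have h2 := h.2
    unfold hypDist at h2 ⊢
    rwa [norm_sub_rev, mul_comm (1 - ‖toDisk (x w)‖ ^ 2)]⟩⟩
  loopless := ⟨fun _ h => h.1 rfl⟩

/-- The uniform distribution on `[0, 2π)`. -/
def angleLaw : Measure ℝ :=
  (volume.restrict (Set.Ico 0 (2 * Real.pi))).withDensity
    fun _ => ENNReal.ofReal (1 / (2 * Real.pi))

/-- The distribution on `[0, R)` with density `α sinh(α r) / (cosh(α R) - 1)`. -/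
def radialLaw (α R : ℝ) : Measure ℝ :=
  (volume.restrict (Set.Ico 0 R)).withDensity
    fun r => ENNReal.ofReal (α * Real.sinh (α * r) / (Real.cosh (α * R) - 1))

/-- The law of `n` independent vertex positions. -/
def vertexLaw (n : ℕ) (α R : ℝ) : Measure (Fin n → ℝ × ℝ) :=
  Measure.pi fun _ => angleLaw.prod (radialLaw α R)

/-! Step counting. The model is a real RAM: arithmetic, comparisons, elementary functions,
memory and pointer operations and drawing one coordinate cost `O(1)`. Every loop iteration and
every procedure call executes a bounded number of these and is charged explicitly below. -/

/-- A computation with result in `β`: `some (b, t)` if it returns `b` after `t` steps, `none` if it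
was cut off by the bound on the recursion depth (only insertion, which need not terminate when
points coincide, carries such a bound). -/
def Timed (β : Type) : Type := Option (β × ℕ)

/-- The computation returns `b` after exactly `t` steps. -/
def Timed.Returns {β : Type} (c : Timed β) (b : β) (t : ℕ) : Prop := c = some (b, t)

instance : Monad Timed where
  pure b := some (b, 0)
  bind {β γ} (c : Option (β × ℕ)) (f : β → Option (γ × ℕ)) :=
    c.bind fun bs => (f bs.1).map fun ct => (ct.1, bs.2 + ct.2)

/-- Spend `k` steps. -/
def tick (k : ℕ) : Timed Unit := some ((), k)

/-- The recursion bound is exhausted. -/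
def cutoff {β : Type} : Timed β := (none : Option (β × ℕ))

/-! The target radius -/

/-- The approximation of the expected average degree (curvature `-1`) that defines the radius. -/
def expectedDegree (n : ℕ) (α R : ℝ) : ℝ :=
  let ξ := α / (α - 1 / 2)
  2 / Real.pi * ξ ^ 2 * n * (Real.exp (-R / 2) + Real.exp (-α * R) *
    (α * (R / 2) * (Real.pi / 4 * (1 / α) ^ 2 - (Real.pi - 1) * (1 / α) + (Real.pi - 2)) - 1))

/-- Binary search in `[lo, hi]` for the radius with average degree `k`. It stops as soon as the
degree is met up to `ε`, or after `rounds` halvings. It returns the radius and the number of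
evaluations. -/
def targetRadius (n : ℕ) (k α ε : ℝ) : ℕ → ℝ → ℝ → ℝ × ℕ
  | 0, lo, hi => ((lo + hi) / 2, 1)
  | rounds + 1, lo, hi =>
    let mid := (lo + hi) / 2
    let d := expectedDegree n α mid
    if |d - k| ≤ ε then (mid, 1)
    else
      let res := if d < k then targetRadius n k α ε rounds lo mid
        else targetRadius n k α ε rounds mid hi
      (res.1, res.2 + 1)

/-! The polar quadtree -/

/-- A cell of the quadtree. The radial boundaries are kept in native coordinates; the
corresponding boundaries in the Poincaré disk are `minE`, `maxE`, `midE`. -/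
structure Cell where
  minφ : ℝ
  maxφ : ℝ
  minH : ℝ
  maxH : ℝ

namespace Cell

def minE (c : Cell) : ℝ := mapToPoincare c.minH

def maxE (c : Cell) : ℝ := mapToPoincare c.maxH

def midφ (c : Cell) : ℝ := (c.maxφ + c.minφ) / 2

/-- The splitting radius, which halves the probability mass. -/
def midH (α : ℝ) (c : Cell) : ℝ :=
  Real.arcosh ((Real.cosh (α * c.maxH) + Real.cosh (α * c.minH)) / 2) / α

def midE (α : ℝ) (c : Cell) : ℝ := mapToPoincare (c.midH α)

/-- The four children of a cell: the first index selects the angular half (`false` the lower one),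
the second one the radial half. -/
def sub (α : ℝ) (c : Cell) (q : Bool × Bool) : Cell where
  minφ := if q.1 then c.midφ else c.minφ
  maxφ := if q.1 then c.maxφ else c.midφ
  minH := if q.2 then c.midH α else c.minH
  maxH := if q.2 then c.maxH else c.midH α

end Cell

/-- A stored vertex with its polar coordinates `(φ, r)` in the Poincaré disk. -/
structure Item (V : Type) where
  id : V
  φ : ℝ
  r : ℝ

/-- The child of a cell that is responsible for a point of the cell. -/
def Cell.quadrant {V : Type} (α : ℝ) (c : Cell) (p : Item V) : Bool × Bool :=
  (decide (c.midφ ≤ p.φ), decide (c.midE α ≤ p.r))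

/-- A node holds its cell and either a list of points or pointers to four children. -/
inductive QuadTree (V : Type) : Type where
  | leaf (c : Cell) (pts : List (Item V)) : QuadTree V
  | node (c : Cell) (child : Bool × Bool → QuadTree V) : QuadTree V

/-- A leaf becomes an inner node, and every point of the leaf moves one level down. -/
def splitLeaf {V : Type} (α : ℝ) (c : Cell) (pts : List (Item V)) : Timed (QuadTree V) := do
  tick (4 * (pts.length + 1))
  pure (.node c fun q => .leaf (c.sub α q) (pts.filter fun p => c.quadrant α p = q))

/-- Insertion into a quadtree with leaf capacity `cap`. The first argument bounds the recursion
depth. -/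
def insert {V : Type} (α : ℝ) (cap : ℕ) : ℕ → QuadTree V → Item V → Timed (QuadTree V)
  | 0, _, _ => cutoff
  | depth + 1, .leaf c pts, p => do
    tick (pts.length + 1)
    if pts.length < cap then
      pure (.leaf c (p :: pts))
    else do
      let T ← splitLeaf α c pts
      insert α cap depth T p
  | depth + 1, .node c child, p => do
    tick 1
    let q := c.quadrant α p
    let T ← insert α cap depth (child q) p
    pure (.node c (Function.update child q T))

/-! Range queries -/

/-- Euclidean distance of two points given in polar coordinates. -/
def polarDist (φ₁ r₁ φ₂ r₂ : ℝ) : ℝ :=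
  √(r₁ ^ 2 + r₂ ^ 2 - 2 * r₁ * r₂ * Real.cos (φ₁ - φ₂))

/-- A Euclidean circle with center in polar coordinates. -/
structure Circle where
  φ : ℝ
  r : ℝ
  rad : ℝ

/-- The Euclidean circle that is the hyperbolic circle of radius `R` around the point of the
Poincaré disk with polar coordinates `(φ, r)`. -/
def circleToEuclidean (R φ r : ℝ) : Circle :=
  let a := Real.cosh R - 1
  let b := 1 - r ^ 2
  { φ := φ
    r := 2 * r / (a * b + 2)
    rad := √((2 * r / (a * b + 2)) ^ 2 - (2 * r ^ 2 - a * b) / (a * b + 2)) }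

/-- Distance of the center of `Q` from the side of the cell `c` at angle `θ`. -/
def Cell.sideDist (c : Cell) (Q : Circle) (θ : ℝ) : ℝ :=
  polarDist Q.φ Q.r θ (max c.minE (min c.maxE (Q.r * Real.cos (Q.φ - θ))))

/-- Euclidean distance of the center of `Q` from the (closed) cell `c`. -/
def Cell.dist (c : Cell) (Q : Circle) : ℝ :=
  if c.minφ ≤ Q.φ ∧ Q.φ ≤ c.maxφ then |Q.r - max c.minE (min c.maxE Q.r)|
  else min (c.sideDist Q c.minφ) (c.sideDist Q c.maxφ)

/-- Report the points of a leaf that lie in the circle. -/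
def scan {V : Type} (Q : Circle) : List (Item V) → List V → Timed (List V)
  | [], acc => pure acc
  | p :: pts, acc => do
    tick 1
    scan Q pts (if polarDist p.φ p.r Q.φ Q.r < Q.rad then p.id :: acc else acc)

/-- Add the vertices inside the circle `Q` to the output `acc`, descending only into cells that
meet the interior of the circle. -/
def verticesInCircle {V : Type} (Q : Circle) : QuadTree V → List V → Timed (List V)
  | .leaf c pts, acc => do
    tick 1
    if Q.rad ≤ c.dist Q then pure acc else scan Q pts acc
  | .node c child, acc => do
    tick 1
    if Q.rad ≤ c.dist Q then pure acc
    else do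
      let acc ← verticesInCircle Q (child (false, false)) acc
      let acc ← verticesInCircle Q (child (false, true)) acc
      let acc ← verticesInCircle Q (child (true, false)) acc
      verticesInCircle Q (child (true, true)) acc

/-! Graph generation. The graph is output as the list of the pairs `(v, w)` of neighbors. -/

/-- The first loop: draw the position `x v` of every vertex `v` and insert `v`. -/
def insertLoop {V : Type} (α : ℝ) (cap depth : ℕ) (x : V → ℝ × ℝ) :
    List V → QuadTree V → Timed (QuadTree V)
  | [], T => pure T
  | v :: vs, T => do
    tick 1
    let T ← insert α cap depth T ⟨v, (x v).1, mapToPoincare (x v).2⟩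
    insertLoop α cap depth x vs T

/-- Add the pairs `(v, w)` with `w ≠ v` in the list to the output. -/
def addEdges {V : Type} [DecidableEq V] (v : V) : List V → List (V × V) → Timed (List (V × V))
  | [], E => pure E
  | w :: ws, E => do
    tick 1
    addEdges v ws (if w = v then E else (v, w) :: E)

/-- The second loop: find the neighbors of every vertex by a range query. -/
def edgeLoop {V : Type} [DecidableEq V] (R : ℝ) (T : QuadTree V) (x : V → ℝ × ℝ) :
    List V → List (V × V) → Timed (List (V × V))
  | [], E => pure E
  | v :: vs, E => do
    tick 1
    let Q := circleToEuclidean R (x v).1 (mapToPoincare (x v).2)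
    let ws ← verticesInCircle Q T []
    let E ← addEdges v ws E
    edgeLoop R T x vs E

/-- The generator on input `n, k, α`, with search interval `[lo, hi]`, tolerance `ε` and number of
rounds for the target radius, and leaf capacity `cap`. The random draws are `x`, and insertions
are cut off at recursion depth `depth`. -/
def generate (cap : ℕ) (n : ℕ) (k α lo hi ε : ℝ) (rounds : ℕ) (x : Fin n → ℝ × ℝ) (depth : ℕ) :
    Timed (List (Fin n × Fin n)) := do
  let (R, s) := targetRadius n k α ε rounds lo hi
  tick s
  let T ← insertLoop α cap depth x (List.finRange n) (.leaf ⟨0, 2 * Real.pi, 0, R⟩ [])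
  edgeLoop R T x (List.finRange n) []

end RHG

end

noncomputable section

namespace RHG

/-! Circles in the Poincaré disk -/

/-! The splitting rule makes the possible quadtree cells at depth `l` exactly the cells of a `2^l ×
2^l` grid in which each cell has mass `4^(-l)` (`gridCell_sub`, `measure_gridCell`). The tree
depends on the random points, but the grids do not, so everything is counted in the grids.

Geometry: a vertex has `r < R`, so its query circle encloses the origin and its interior is
star-shaped about it. The boundary then crosses only `O(N)` of the `N²` grid cells
(`card_boundary_cells_le`).

Cost of a query: an expanded inner node is occupied and its cell meets the circle. Either the cell
contains a reported vertex, and at each level the number of such cells is at most the number of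
hits; or it contains a vertex outside the circle, so the circle straddles it (`sum_expanded_le`).
Let `N = 2^L₀` be about `√n`. Down to level `L₀` there are at most `9N` straddled cells per level.
Deeper straddled cells lie in straddled cells of level `L₀`, so the occupied ones number at most the
vertices in those (`card_occupied_straddlingCells_le`).

Probability: the straddled cells of level `L₀` have mass at most `9/N`, hence hold `O(√n)` vertices.
A union bound over vertices and over sets of `216N` other vertices makes this hold for all circles
at once (`measure_exists_many_le`, `straddling_bound`). A grid of side at least `n²` separates all
points, so only `O(log n)` levels matter (`measure_exists_collision_le`). Together these fail with
probability at most `1/n` (`measure_not_good_le`).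

On the good event insertion terminates and the output is exact (`generate_returns`). Every query
costs `O((√n + hits) log n)`, and the hits sum to at most `n + 2m` (`steps_le`). Of the radius
search only `R > 0` and its number of rounds are used; how well `R` fits the target degree plays no
role. -/

lemma mapToPoincare_nonneg (r : ℝ) : 0 ≤ mapToPoincare r := Real.sqrt_nonneg _

lemma mapToPoincare_sq (r : ℝ) :
    mapToPoincare r ^ 2 = (Real.cosh r - 1) / (Real.cosh r + 1) := by
  have := Real.one_le_cosh r
  exact Real.sq_sqrt (div_nonneg (by linarith) (by linarith))

lemma mapToPoincare_sq_lt_one (r : ℝ) : mapToPoincare r ^ 2 < 1 := by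
  have := Real.one_le_cosh r
  rw [mapToPoincare_sq, div_lt_one (by linarith)]
  linarith

lemma continuous_mapToPoincare : Continuous mapToPoincare := by
  unfold mapToPoincare
  refine Continuous.sqrt (Continuous.div ?_ ?_ fun r => ?_)
  · exact Real.continuous_cosh.sub continuous_const
  · exact Real.continuous_cosh.add continuous_const
  · have := Real.one_le_cosh r
    linarith

lemma mapToPoincare_strictMonoOn : StrictMonoOn mapToPoincare (Set.Ici 0) := by
  intro r hr s hs hrs
  have h := Real.cosh_strictMonoOn hr hs hrs
  have h1 := Real.one_le_cosh r
  refine Real.sqrt_lt_sqrt (div_nonneg (by linarith) (by linarith)) ?_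
  rw [div_lt_div_iff₀ (by linarith) (by linarith)]
  nlinarith

/-- The point with polar coordinates `(φ, r)` lies inside the circle. -/
def Circle.Inside (Q : Circle) (φ r : ℝ) : Prop := polarDist φ r Q.φ Q.r < Q.rad

/-- The circle is centered at an angle in `[0, 2π)` and encloses the origin. -/
structure Circle.Central (Q : Circle) : Prop where
  φ_nonneg : 0 ≤ Q.φ
  φ_lt : Q.φ < 2 * Real.pi
  r_nonneg : 0 ≤ Q.r
  r_lt : Q.r < Q.rad

lemma polarDist_sq_nonneg (φ₁ r₁ φ₂ r₂ : ℝ) :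
    0 ≤ r₁ ^ 2 + r₂ ^ 2 - 2 * r₁ * r₂ * Real.cos (φ₁ - φ₂) := by
  have h := Real.sin_sq_add_cos_sq (φ₁ - φ₂)
  have : r₁ ^ 2 + r₂ ^ 2 - 2 * r₁ * r₂ * Real.cos (φ₁ - φ₂) =
      (r₁ - r₂ * Real.cos (φ₁ - φ₂)) ^ 2 + (r₂ * Real.sin (φ₁ - φ₂)) ^ 2 := by
    linear_combination (-r₂ ^ 2) * h
  rw [this]
  positivity

lemma polarDist_sq (φ₁ r₁ φ₂ r₂ : ℝ) :
    polarDist φ₁ r₁ φ₂ r₂ ^ 2 = r₁ ^ 2 + r₂ ^ 2 - 2 * r₁ * r₂ * Real.cos (φ₁ - φ₂) :=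
  Real.sq_sqrt (polarDist_sq_nonneg _ _ _ _)

lemma polarDist_comm (φ₁ r₁ φ₂ r₂ : ℝ) : polarDist φ₁ r₁ φ₂ r₂ = polarDist φ₂ r₂ φ₁ r₁ := by
  unfold polarDist
  rw [← Real.cos_neg (φ₁ - φ₂), neg_sub]
  congr 1
  ring

lemma Circle.inside_iff {Q : Circle} (h : 0 < Q.rad) (φ r : ℝ) :
    Q.Inside φ r ↔ r ^ 2 + Q.r ^ 2 - 2 * r * Q.r * Real.cos (φ - Q.φ) < Q.rad ^ 2 := by
  rw [Circle.Inside, ← polarDist_sq, sq_lt_sq₀ (show 0 ≤ polarDist _ _ _ _ from Real.sqrt_nonneg _) h.le]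

lemma Circle.Central.rad_pos {Q : Circle} (h : Q.Central) : 0 < Q.rad := h.r_nonneg.trans_lt h.r_lt

/-- A disk containing the origin is star-shaped about it. Algebraically, with `q = Q.r`, the term `r
(r - 2 q cos)` is nonpositive for `r` up to `2 q cos`, where `q < rad` suffices, and increasing
beyond. -/
lemma Circle.Inside.anti {Q : Circle} (hQ : Q.Central) {φ r s : ℝ} (h : Q.Inside φ s)
    (hr : 0 ≤ r) (hrs : r ≤ s) : Q.Inside φ r := by
  rw [Circle.inside_iff hQ.rad_pos] at h ⊢
  have hκ : Q.r ^ 2 < Q.rad ^ 2 := pow_lt_pow_left₀ hQ.r_lt hQ.r_nonneg two_ne_zero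
  rcases le_total r (2 * Q.r * Real.cos (φ - Q.φ)) with h1 | h1
  · nlinarith
  · nlinarith

lemma continuous_circle (R : ℝ) :
    Continuous (fun y : ℝ × ℝ => (circleToEuclidean R y.1 (mapToPoincare y.2)).r) ∧
    Continuous (fun y : ℝ × ℝ => (circleToEuclidean R y.1 (mapToPoincare y.2)).rad) := by
  have hg : Continuous fun y : ℝ × ℝ => mapToPoincare y.2 :=
    continuous_mapToPoincare.comp continuous_snd
  have hden : ∀ y : ℝ × ℝ, (Real.cosh R - 1) * (1 - mapToPoincare y.2 ^ 2) + 2 ≠ 0 := fun y => by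
    have h1 := Real.one_le_cosh R
    have h2 := mapToPoincare_sq_lt_one y.2
    have := mul_nonneg (sub_nonneg.2 h1) (sub_nonneg.2 h2.le)
    linarith
  have hd : Continuous fun y : ℝ × ℝ =>
      (Real.cosh R - 1) * (1 - mapToPoincare y.2 ^ 2) + 2 := by fun_prop
  have h1 : Continuous fun y : ℝ × ℝ =>
      2 * mapToPoincare y.2 / ((Real.cosh R - 1) * (1 - mapToPoincare y.2 ^ 2) + 2) :=
    Continuous.div (by fun_prop) hd hden
  refine ⟨h1, Continuous.sqrt ((h1.pow 2).sub (Continuous.div (by fun_prop) hd hden))⟩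

/-- The origin is enclosed because the numerator `2ρ² - ab` has the sign of `cosh r - cosh R`, which
is negative for `r < R`. -/
lemma circle_central {R φ r : ℝ} (hφ : 0 ≤ φ) (hφ' : φ < 2 * Real.pi) (hr : 0 ≤ r) (hrR : r < R) :
    (circleToEuclidean R φ (mapToPoincare r)).Central := by
  have h1 := Real.one_le_cosh r
  have hc := Real.cosh_strictMonoOn (Set.mem_Ici.2 hr) (Set.mem_Ici.2 (hr.trans hrR.le)) hrR
  have h2 := mapToPoincare_sq_lt_one r
  have hab := mul_nonneg (sub_nonneg.2 (h1.trans hc.le)) (sub_nonneg.2 h2.le)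
  have hq : 0 ≤ (circleToEuclidean R φ (mapToPoincare r)).r :=
    div_nonneg (mul_nonneg two_pos.le (mapToPoincare_nonneg r)) (by linarith)
  refine ⟨hφ, hφ', hq, Real.lt_sqrt_of_sq_lt ?_⟩
  have hneg : (2 * mapToPoincare r ^ 2 - (Real.cosh R - 1) * (1 - mapToPoincare r ^ 2)) /
      ((Real.cosh R - 1) * (1 - mapToPoincare r ^ 2) + 2) < 0 := by
    refine div_neg_of_neg_of_pos ?_ (by linarith)
    rw [mapToPoincare_sq]
    have : 2 * ((Real.cosh r - 1) / (Real.cosh r + 1)) - (Real.cosh R - 1) *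
        (1 - (Real.cosh r - 1) / (Real.cosh r + 1)) =
        2 * (Real.cosh r - Real.cosh R) / (Real.cosh r + 1) := by
      field_simp
      ring
    rw [this]
    exact div_neg_of_neg_of_pos (by linarith) (by linarith)
  simp only [circleToEuclidean]
  linarith

lemma toDisk_eq (p : ℝ × ℝ) :
    toDisk p = ⟨mapToPoincare p.2 * Real.cos p.1, mapToPoincare p.2 * Real.sin p.1⟩ := by
  apply Complex.ext <;>
    simp [toDisk, Complex.exp_ofReal_mul_I_re, Complex.exp_ofReal_mul_I_im]

lemma norm_toDisk_sq (p : ℝ × ℝ) : ‖toDisk p‖ ^ 2 = mapToPoincare p.2 ^ 2 := by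
  rw [Complex.sq_norm, toDisk_eq, Complex.normSq_mk]
  linear_combination (mapToPoincare p.2 ^ 2) * Real.sin_sq_add_cos_sq p.1

lemma norm_toDisk_sub_sq (p q : ℝ × ℝ) :
    ‖toDisk p - toDisk q‖ ^ 2 = mapToPoincare p.2 ^ 2 + mapToPoincare q.2 ^ 2 -
      2 * mapToPoincare p.2 * mapToPoincare q.2 * Real.cos (q.1 - p.1) := by
  rw [Complex.sq_norm, toDisk_eq, toDisk_eq, Real.cos_sub]
  simp only [Complex.normSq_apply, Complex.sub_re, Complex.sub_im]
  linear_combination (mapToPoincare p.2 ^ 2) * Real.sin_sq_add_cos_sq p.1 +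
    (mapToPoincare q.2 ^ 2) * Real.sin_sq_add_cos_sq q.1

/-- After clearing denominators both sides state that one polynomial is negative; they differ by the
positive factor `2 / (ab + 2)`. This is the exactness of the range query. -/
lemma hypDist_lt_iff {R : ℝ} (hR : 0 < R) (p q : ℝ × ℝ)
    (hQ : (circleToEuclidean R p.1 (mapToPoincare p.2)).Central) :
    hypDist (toDisk p) (toDisk q) < R ↔
      (circleToEuclidean R p.1 (mapToPoincare p.2)).Inside q.1 (mapToPoincare q.2) := by
  have hp := mapToPoincare_sq_lt_one p.2
  have hq := mapToPoincare_sq_lt_one q.2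
  have hcR := Real.one_le_cosh R
  have hab := mul_nonneg (sub_nonneg.2 hcR) (sub_nonneg.2 hp.le)
  have hpos := mul_pos (sub_pos.2 hp) (sub_pos.2 hq)
  rw [Circle.inside_iff hQ.rad_pos]
  have hrad : (circleToEuclidean R p.1 (mapToPoincare p.2)).rad ^ 2 =
      (2 * mapToPoincare p.2 / ((Real.cosh R - 1) * (1 - mapToPoincare p.2 ^ 2) + 2)) ^ 2 -
      (2 * mapToPoincare p.2 ^ 2 - (Real.cosh R - 1) * (1 - mapToPoincare p.2 ^ 2)) /
      ((Real.cosh R - 1) * (1 - mapToPoincare p.2 ^ 2) + 2) :=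
    Real.sq_sqrt (Real.sqrt_pos.1 hQ.rad_pos).le
  rw [hrad, hypDist]
  conv_lhs => rw [← Real.arcosh_cosh hR.le]
  rw [Real.arcosh_lt_arcosh (add_pos_of_pos_of_nonneg one_pos (mul_nonneg two_pos.le (div_nonneg (sq_nonneg _) (by rw [norm_toDisk_sq, norm_toDisk_sq]; exact hpos.le)))) (Real.cosh_pos R), norm_toDisk_sub_sq,
    norm_toDisk_sq, norm_toDisk_sq, ← lt_sub_iff_add_lt', ← lt_div_iff₀' two_pos,
    div_lt_iff₀ hpos]
  simp only [circleToEuclidean]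
  generalize Real.cos (q.1 - p.1) = c
  generalize mapToPoincare p.2 = u at *
  generalize mapToPoincare q.2 = w at *
  generalize Real.cosh R - 1 = a at *
  have hd : 0 < a * (1 - u ^ 2) + 2 := by linarith
  rw [← sub_neg, ← sub_neg (a := w ^ 2 + _ - _)]
  have : w ^ 2 + (2 * u / (a * (1 - u ^ 2) + 2)) ^ 2 -
      2 * w * (2 * u / (a * (1 - u ^ 2) + 2)) * c -
      ((2 * u / (a * (1 - u ^ 2) + 2)) ^ 2 -
        (2 * u ^ 2 - a * (1 - u ^ 2)) / (a * (1 - u ^ 2) + 2)) =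
      (u ^ 2 + w ^ 2 - 2 * u * w * c - a / 2 * ((1 - u ^ 2) * (1 - w ^ 2))) *
        (2 / (a * (1 - u ^ 2) + 2)) := by
    field_simp
    ring
  rw [this]
  exact ⟨fun h => mul_neg_of_neg_of_pos h (by positivity),
    fun h => neg_of_mul_neg_left h (by positivity)⟩

/-! Cells and circles -/

/-- The closed cell contains the point with polar coordinates `(φ, r)` in the disk. -/
def Cell.Covers (c : Cell) (φ r : ℝ) : Prop :=
  (c.minφ ≤ φ ∧ φ ≤ c.maxφ) ∧ c.minE ≤ r ∧ r ≤ c.maxE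

/-- The closed cell meets the interior of the circle. -/
def Cell.Meets (c : Cell) (Q : Circle) : Prop := ∃ φ r, c.Covers φ r ∧ Q.Inside φ r

/-- The closed cell is not contained in the interior of the circle. -/
def Cell.Exits (c : Cell) (Q : Circle) : Prop := ∃ φ r, c.Covers φ r ∧ ¬ Q.Inside φ r

def Cell.Straddles (c : Cell) (Q : Circle) : Prop := c.Meets Q ∧ c.Exits Q

lemma cos_le_max_cos {a x b : ℝ} (ha : 0 ≤ a) (hax : a ≤ x) (hxb : x ≤ b)
    (hb : b ≤ 2 * Real.pi) : Real.cos x ≤ max (Real.cos a) (Real.cos b) := by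
  rcases le_total x Real.pi with h | h
  · exact le_max_of_le_left (Real.cos_le_cos_of_nonneg_of_le_pi ha h hax)
  · refine le_max_of_le_right ?_
    rw [← Real.cos_two_pi_sub x, ← Real.cos_two_pi_sub b]
    exact Real.cos_le_cos_of_nonneg_of_le_pi (by linarith) (by linarith) (by linarith)

lemma abs_clamp_sub_le {m M r s : ℝ} (h1 : m ≤ r) (h2 : r ≤ M) :
    |max m (min M s) - s| ≤ |r - s| := by
  rcases le_total M s with h | h
  · rw [min_eq_left h, max_eq_right (h1.trans h2), abs_of_nonpos (by linarith),
      abs_of_nonpos (by linarith)]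
    linarith
  · rw [min_eq_right h]
    rcases le_total m s with h' | h'
    · rw [max_eq_right h']
      simp
    · rw [max_eq_left h', abs_of_nonneg (by linarith), abs_of_nonneg (by linarith)]
      linarith

/-- Along a fixed ray the squared distance is a parabola with vertex at `Q.r * cos`, so clamping the
vertex to the radial range gives the nearest point. Turning the ray towards the center only
decreases the distance. -/
lemma Cell.sideDist_le {c : Cell} {Q : Circle} {φ θ r : ℝ} (h0 : 0 ≤ Q.r) (hr : 0 ≤ r)
    (h1 : c.minE ≤ r) (h2 : r ≤ c.maxE) (hcos : Real.cos (φ - Q.φ) ≤ Real.cos (θ - Q.φ)) :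
    c.sideDist Q θ ≤ polarDist φ r Q.φ Q.r := by
  have h := abs_clamp_sub_le (s := Q.r * Real.cos (Q.φ - θ)) h1 h2
  rw [← sq_le_sq] at h
  rw [Cell.sideDist, polarDist_comm φ]
  refine Real.sqrt_le_sqrt ?_
  have e : Real.cos (θ - Q.φ) = Real.cos (Q.φ - θ) := by rw [← Real.cos_neg, neg_sub]
  have e' : Real.cos (φ - Q.φ) = Real.cos (Q.φ - φ) := by rw [← Real.cos_neg, neg_sub]
  rw [e, e'] at hcos
  have h3 := mul_le_mul_of_nonneg_left hcos (mul_nonneg hr h0)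
  nlinarith

/-- Soundness of pruning. Off the center's angular range, the cosine of the angle to the center is
largest at one of the two sides of the cell. -/
lemma Cell.dist_le {c : Cell} {Q : Circle} {φ r : ℝ} (hQ : Q.Central) (hE : 0 ≤ c.minE)
    (hφ0 : 0 ≤ c.minφ) (hφ1 : c.maxφ ≤ 2 * Real.pi) (h : c.Covers φ r) :
    c.dist Q ≤ polarDist φ r Q.φ Q.r := by
  obtain ⟨⟨h1, h2⟩, h3, h4⟩ := h
  have hr := hE.trans h3
  have q1 := hQ.φ_nonneg
  have q2 := hQ.φ_lt
  unfold Cell.dist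
  split_ifs with hc
  · refine Real.le_sqrt_of_sq_le ?_
    rw [sq_abs]
    have h5 := abs_clamp_sub_le (s := Q.r) h3 h4
    rw [← sq_le_sq] at h5
    have h6 := mul_le_mul_of_nonneg_left (Real.cos_le_one (φ - Q.φ)) (mul_nonneg hr hQ.r_nonneg)
    nlinarith
  · have key : Real.cos (φ - Q.φ) ≤
        max (Real.cos (c.minφ - Q.φ)) (Real.cos (c.maxφ - Q.φ)) := by
      rw [not_and_or, not_le, not_le] at hc
      rcases hc with hc | hc
      · exact cos_le_max_cos (by linarith) (by linarith) (by linarith) (by linarith)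
      · rw [← Real.cos_neg (φ - _), ← Real.cos_neg (c.minφ - _), ← Real.cos_neg (c.maxφ - _),
          max_comm]
        exact cos_le_max_cos (by linarith) (by linarith) (by linarith) (by linarith)
    rcases le_max_iff.1 key with hk | hk
    · exact min_le_of_left_le (Cell.sideDist_le hQ.r_nonneg hr h3 h4 hk)
    · exact min_le_of_right_le (Cell.sideDist_le hQ.r_nonneg hr h3 h4 hk)

/-- The distance is attained in the closed cell, so a cell that is not pruned really meets the
circle. The cost bound, unlike correctness, needs this direction. -/
lemma Cell.meets_of_dist_lt {c : Cell} {Q : Circle} (hE : c.minE ≤ c.maxE)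
    (hφ : c.minφ ≤ c.maxφ) (h : c.dist Q < Q.rad) : c.Meets Q := by
  have hcl : ∀ s, c.minE ≤ max c.minE (min c.maxE s) ∧ max c.minE (min c.maxE s) ≤ c.maxE :=
    fun s => ⟨le_max_left _ _, max_le hE (min_le_left _ _)⟩
  unfold Cell.dist at h
  split_ifs at h with hc
  · refine ⟨Q.φ, _, ⟨hc, hcl Q.r⟩, ?_⟩
    rw [Circle.Inside]
    convert h using 1
    rw [polarDist, ← Real.sqrt_sq_eq_abs, sub_self, Real.cos_zero]
    congr 1
    ring
  · rcases min_lt_iff.1 h with h | h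
    · rw [Cell.sideDist, polarDist_comm] at h
      exact ⟨c.minφ, _, ⟨⟨le_rfl, hφ⟩, hcl _⟩, h⟩
    · rw [Cell.sideDist, polarDist_comm] at h
      exact ⟨c.maxφ, _, ⟨⟨hφ, le_rfl⟩, hcl _⟩, h⟩

/-! Columns of a grid and circles -/

/-- The `i`-th of `N` angular columns. -/
def column (N i : ℕ) : Set ℝ := Set.Icc (2 * Real.pi * (i / N)) (2 * Real.pi * ((i + 1) / N))

lemma column_nonempty (N i : ℕ) : (column N i).Nonempty := by
  refine Set.nonempty_Icc.2 (mul_le_mul_of_nonneg_left ?_ (by positivity))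
  gcongr
  linarith

/-- The admitted range of `θ - φ` spans two periods: two signs times two branches of `arccos` give
four candidates. -/
lemma eq_of_cos_eq {θ φ t : ℝ} (h : |θ - φ| ≤ 2 * Real.pi) (ht : Real.cos (θ - φ) = t) :
    θ ∈ ({φ + Real.arccos t, φ - Real.arccos t, φ + (2 * Real.pi - Real.arccos t),
      φ - (2 * Real.pi - Real.arccos t)} : Finset ℝ) := by
  simp only [Finset.mem_insert, Finset.mem_singleton]
  rw [← Real.cos_abs] at ht
  have hc : |θ - φ| = Real.arccos t ∨ |θ - φ| = 2 * Real.pi - Real.arccos t := by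
    rcases le_total |θ - φ| Real.pi with h' | h'
    · left
      rw [← ht, Real.arccos_cos (abs_nonneg _) h']
    · right
      rw [← ht, ← Real.cos_two_pi_sub, Real.arccos_cos (by linarith) (by linarith)]
      ring
  rcases hc with hc | hc <;> rcases abs_choice (θ - φ) with h' | h' <;> rw [h'] at hc
  · left; linarith
  · right; left; linarith
  · right; right; left; linarith
  · right; right; right; linarith

lemma mem_column_iff {N i : ℕ} (hN : 0 < N) {θ : ℝ} :
    θ ∈ column N i ↔ (i : ℝ) ≤ θ * N / (2 * Real.pi) ∧ θ * N / (2 * Real.pi) ≤ i + 1 := by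
  have hN' : (0 : ℝ) < N := by exact_mod_cast hN
  have hp := Real.pi_pos
  rw [column, Set.mem_Icc, le_div_iff₀ (by positivity), div_le_iff₀ (by positivity),
    ← mul_div_assoc, ← mul_div_assoc, div_le_iff₀ hN', le_div_iff₀ hN']
  constructor <;> rintro ⟨h1, h2⟩ <;> constructor <;> linarith

open Classical in
/-- At a fixed radius, a circle has at most four boundary points. -/
lemma card_mixed_columns_le {Q : Circle} (hQ : Q.Central) {N : ℕ} (hN : 0 < N) (r : ℝ) :
    ((Finset.range N).filter fun i => (∃ φ ∈ column N i, Q.Inside φ r) ∧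
      ∃ φ ∈ column N i, ¬ Q.Inside φ r).card ≤ 8 := by
  set t := (r ^ 2 + Q.r ^ 2 - Q.rad ^ 2) / (2 * r * Q.r) with ht
  set Z : Finset ℝ := {Q.φ + Real.arccos t, Q.φ - Real.arccos t,
    Q.φ + (2 * Real.pi - Real.arccos t), Q.φ - (2 * Real.pi - Real.arccos t)} with hZ
  have hZc : Z.card ≤ 4 := Finset.card_le_four
  set f : ℝ → ℕ := fun θ => ⌊θ * N / (2 * Real.pi)⌋₊
  have hN' : (0 : ℝ) < N := by exact_mod_cast hN
  have hp := Real.pi_pos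
  have hsub : ((Finset.range N).filter fun i => (∃ φ ∈ column N i, Q.Inside φ r) ∧
      ∃ φ ∈ column N i, ¬ Q.Inside φ r) ⊆ Z.image f ∪ Z.image fun θ => f θ - 1 := by
    intro i hi
    obtain ⟨hiN, ⟨φ₁, h1, h1'⟩, φ₂, h2, h2'⟩ := Finset.mem_filter.1 hi
    have hiN : i < N := Finset.mem_range.1 hiN
    rw [Circle.inside_iff hQ.rad_pos] at h1' h2'
    rw [not_lt] at h2'
    obtain ⟨θ, hθ, hθ'⟩ := isPreconnected_Icc.intermediate_value h1 h2
      (f := fun φ => r ^ 2 + Q.r ^ 2 - 2 * r * Q.r * Real.cos (φ - Q.φ))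
      (by fun_prop) ⟨h1'.le, h2'⟩
    simp only at hθ'
    -- If this product vanished, being inside would not depend on the angle and no column could be
    -- mixed.
    have hne : 2 * r * Q.r ≠ 0 := by
      intro h
      rw [h] at h1' h2'
      linarith
    have hcos : Real.cos (θ - Q.φ) = t := by
      rw [ht, eq_div_iff hne]
      linarith
    have hθ0 : 0 ≤ θ := le_trans (by positivity) hθ.1
    have hθ1 : θ ≤ 2 * Real.pi := by
      refine hθ.2.trans (mul_le_of_le_one_right (by positivity) ?_)
      rw [div_le_one hN']
      exact_mod_cast hiN
    have hmem : θ ∈ Z := eq_of_cos_eq (abs_le.2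
      ⟨by linarith [hQ.φ_lt], by linarith [hQ.φ_nonneg]⟩) hcos
    obtain ⟨h3, h4⟩ := (mem_column_iff hN).1 hθ
    have h5 : i ≤ f θ := Nat.le_floor h3
    have h6 : f θ ≤ i + 1 := by
      have := Nat.floor_le_floor h4
      rwa [← Nat.cast_succ, Nat.floor_natCast] at this
    -- Columns are closed, so `θ` may be the right endpoint of column `i`, where the floor is `i +
    -- 1`. Hence two columns per boundary angle, eight in all.
    rw [Finset.mem_union, Finset.mem_image, Finset.mem_image]
    rcases h5.eq_or_lt with h5 | h5
    · exact Or.inl ⟨θ, hmem, h5.symm⟩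
    · exact Or.inr ⟨θ, hmem, by omega⟩
  calc _ ≤ _ := Finset.card_le_card hsub
    _ ≤ _ := Finset.card_union_le _ _
    _ ≤ Z.card + Z.card := add_le_add Finset.card_image_le Finset.card_image_le
    _ ≤ 8 := by omega

open Classical in
/-- The number of cells of an `N × N` grid that meet the boundary of a circle is `O(N)`. -/
lemma card_boundary_cells_le {Q : Circle} (hQ : Q.Central) {N : ℕ} (hN : 0 < N) {ρ : ℕ → ℝ}
    (hρ : Monotone ρ) (hρ0 : 0 ≤ ρ 0) :
    ((Finset.range N ×ˢ Finset.range N).filter fun ij : ℕ × ℕ =>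
      (∃ φ ∈ column N ij.1, Q.Inside φ (ρ ij.2)) ∧
      ∃ φ ∈ column N ij.1, ¬ Q.Inside φ (ρ (ij.2 + 1))).card ≤ 9 * N := by
  -- `I j` collects the columns partly inside at radius `ρ j`, `O j` those wholly inside. Row `j` of
  -- the counted cells is `I j \ O (j + 1)`.
  set I : ℕ → Finset ℕ := fun j => (Finset.range N).filter fun i =>
    ∃ φ ∈ column N i, Q.Inside φ (ρ j) with hI
  set O : ℕ → Finset ℕ := fun j => (Finset.range N).filter fun i =>
    ∀ φ ∈ column N i, Q.Inside φ (ρ j) with hO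
  have hρnn : ∀ j, 0 ≤ ρ j := fun j => hρ0.trans (hρ (Nat.zero_le j))
  have hOI : ∀ j, O j ⊆ I j := fun j i hi => by
    obtain ⟨h1, h2⟩ := Finset.mem_filter.1 hi
    obtain ⟨φ, hφ⟩ := column_nonempty N i
    exact Finset.mem_filter.2 ⟨h1, φ, hφ, h2 φ hφ⟩
  have hOO : ∀ j, O (j + 1) ⊆ O j := fun j i hi => by
    obtain ⟨h1, h2⟩ := Finset.mem_filter.1 hi
    exact Finset.mem_filter.2 ⟨h1, fun φ hφ =>
      (h2 φ hφ).anti hQ (hρnn j) (hρ (Nat.le_succ j))⟩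
  have hmix : ∀ j, (I j \ O j).card ≤ 8 := fun j => by
    refine le_trans (Finset.card_le_card ?_) (card_mixed_columns_le hQ hN (ρ j))
    intro i hi
    obtain ⟨h1, h2⟩ := Finset.mem_sdiff.1 hi
    obtain ⟨h3, h4⟩ := Finset.mem_filter.1 h1
    refine Finset.mem_filter.2 ⟨h3, h4, ?_⟩
    by_contra hcon
    push Not at hcon
    exact h2 (Finset.mem_filter.2 ⟨h3, hcon⟩)
  -- Telescoping: row `j` contributes `|I j| - |O (j + 1)| ≤ 8 + |O j| - |O (j + 1)|`, and `|O 0| ≤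
  -- N`.
  have hsum : ∀ m, ∑ j ∈ Finset.range m, (I j \ O (j + 1)).card + (O m).card ≤ N + 8 * m := by
    intro m
    induction m with
    | zero => simpa using (Finset.card_filter_le (Finset.range N) _)
    | succ m ih =>
      rw [Finset.sum_range_succ]
      have e1 := Finset.card_sdiff_add_card_eq_card ((hOO m).trans (hOI m))
      have e2 := Finset.card_sdiff_add_card_eq_card (hOI m)
      have e3 := hmix m
      omega
  have hcard : ((Finset.range N ×ˢ Finset.range N).filter fun ij : ℕ × ℕ =>
      (∃ φ ∈ column N ij.1, Q.Inside φ (ρ ij.2)) ∧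
      ∃ φ ∈ column N ij.1, ¬ Q.Inside φ (ρ (ij.2 + 1))).card ≤
      ∑ j ∈ Finset.range N, (I j \ O (j + 1)).card := by
    rw [← Finset.card_sigma]
    refine Finset.card_le_card_of_injOn (fun ij => ⟨ij.2, ij.1⟩) ?_ ?_
    · intro ij hij
      obtain ⟨h1, h2, φ, h3, h4⟩ := Finset.mem_filter.1 hij
      obtain ⟨h5, h6⟩ := Finset.mem_product.1 h1
      refine Finset.mem_sigma.2 ⟨h6, Finset.mem_sdiff.2 ⟨Finset.mem_filter.2 ⟨h5, h2⟩, ?_⟩⟩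
      intro hcon
      exact h4 ((Finset.mem_filter.1 hcon).2 φ h3)
    · rintro ⟨a, b⟩ - ⟨c, d⟩ - h
      simp only [Sigma.mk.injEq, heq_eq_eq] at h
      exact Prod.ext h.2 h.1
  have := hsum N
  omega

/-! The grid of potential quadtree cells -/

/-- The native radius below which a fraction `u` of the radial mass lies. -/
def radialQuantile (α R u : ℝ) : ℝ := Real.arcosh (1 + (Real.cosh (α * R) - 1) * u) / α

/-- The cell in column `i` and row `j` of the `N × N` grid of cells of equal probability mass. -/
def gridCell (α R : ℝ) (N i j : ℕ) : Cell where
  minφ := 2 * Real.pi * (i / N)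
  maxφ := 2 * Real.pi * ((i + 1) / N)
  minH := radialQuantile α R (j / N)
  maxH := radialQuantile α R ((j + 1) / N)

def Cell.Contains (c : Cell) (p : ℝ × ℝ) : Prop :=
  (c.minφ ≤ p.1 ∧ p.1 < c.maxφ) ∧ c.minH ≤ p.2 ∧ p.2 < c.maxH

section Grid

variable {α R : ℝ}

lemma one_lt_cosh_mul (hα : 0 < α) (hR : 0 < R) : 1 < Real.cosh (α * R) :=
  Real.one_lt_cosh.2 (mul_pos hα hR).ne'

lemma one_le_quantile_arg (hα : 0 < α) (hR : 0 < R) {u : ℝ} (hu : 0 ≤ u) :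
    1 ≤ 1 + (Real.cosh (α * R) - 1) * u := by
  have := mul_nonneg (sub_pos.2 (one_lt_cosh_mul hα hR)).le hu
  linarith

lemma cosh_radialQuantile (hα : 0 < α) (hR : 0 < R) {u : ℝ} (hu : 0 ≤ u) :
    Real.cosh (α * radialQuantile α R u) = 1 + (Real.cosh (α * R) - 1) * u := by
  rw [radialQuantile, mul_div_cancel₀ _ hα.ne', Real.cosh_arcosh (one_le_quantile_arg hα hR hu)]

lemma radialQuantile_zero : radialQuantile α R 0 = 0 := by
  simp [radialQuantile]

lemma radialQuantile_one (hα : 0 < α) (hR : 0 < R) : radialQuantile α R 1 = R := by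
  rw [radialQuantile, mul_one, add_sub_cancel, Real.arcosh_cosh (mul_pos hα hR).le,
    mul_div_cancel_left₀ _ hα.ne']

lemma radialQuantile_strictMonoOn (hα : 0 < α) (hR : 0 < R) :
    StrictMonoOn (radialQuantile α R) (Set.Ici 0) := by
  intro u hu v hv huv
  have h1 := one_le_quantile_arg hα hR hu
  have h2 := one_le_quantile_arg hα hR hv
  refine div_lt_div_of_pos_right ((Real.arcosh_lt_arcosh (by linarith) (by linarith)).2 ?_) hα
  have := mul_lt_mul_of_pos_left huv (sub_pos.2 (one_lt_cosh_mul hα hR))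
  linarith

lemma radialQuantile_nonneg (hα : 0 < α) (hR : 0 < R) {u : ℝ} (hu : 0 ≤ u) :
    0 ≤ radialQuantile α R u :=
  div_nonneg (Real.arcosh_nonneg (one_le_quantile_arg hα hR hu)) hα.le

lemma gridCell_one (hα : 0 < α) (hR : 0 < R) : gridCell α R 1 0 0 = ⟨0, 2 * Real.pi, 0, R⟩ := by
  simp [gridCell, radialQuantile_zero, radialQuantile_one hα hR]

/-- The mass fraction below radius `r` is affine in `cosh (α r)`, so averaging the two values of
`cosh` averages the mass fractions. -/
lemma gridCell_midH (hα : 0 < α) (hR : 0 < R) (N i j : ℕ) :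
    (gridCell α R N i j).midH α = radialQuantile α R ((2 * j + 1) / (2 * N)) := by
  rw [Cell.midH, radialQuantile]
  congr 2
  simp only [gridCell]
  rw [cosh_radialQuantile hα hR (by positivity), cosh_radialQuantile hα hR (by positivity)]
  by_cases hN : (N : ℝ) = 0
  · simp [hN]
  · field_simp
    ring

lemma gridCell_midφ (N i j : ℕ) :
    (gridCell α R N i j).midφ = 2 * Real.pi * ((2 * i + 1) / (2 * N)) := by
  simp only [gridCell, Cell.midφ]
  by_cases hN : (N : ℝ) = 0
  · simp [hN]
  · field_simp
    ring

lemma gridCell_sub (hα : 0 < α) (hR : 0 < R) (N i j : ℕ) (q : Bool × Bool) :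
    (gridCell α R N i j).sub α q =
      gridCell α R (2 * N) (2 * i + q.1.toNat) (2 * j + q.2.toNat) := by
  have e1 : ∀ k : ℕ, (2 * (k : ℝ)) / (2 * N) = k / N := fun k => mul_div_mul_left _ _ two_ne_zero
  have e2 : ∀ k : ℕ, (2 * (k : ℝ) + 1 + 1) / (2 * N) = (k + 1) / N := fun k => by
    rw [← mul_div_mul_left ((k : ℝ) + 1) _ two_ne_zero]
    ring
  obtain ⟨a, b⟩ := q
  rw [Cell.sub, gridCell_midH hα hR, gridCell_midφ]
  cases a <;> cases b <;> simp [gridCell, e1, e2]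

lemma gridCell_minE_nonneg (N i j : ℕ) : 0 ≤ (gridCell α R N i j).minE := mapToPoincare_nonneg _

lemma gridCell_maxE (N i j : ℕ) : (gridCell α R N i j).maxE =
    mapToPoincare (radialQuantile α R ((j + 1 : ℕ) / N)) := by
  rw [Nat.cast_add_one]
  rfl

lemma monotone_grid_radius (hα : 0 < α) (hR : 0 < R) (N : ℕ) :
    Monotone fun j : ℕ => mapToPoincare (radialQuantile α R (j / N)) := by
  intro j k hjk
  have h : (j : ℝ) / N ≤ k / N := by gcongr
  have hj : (0 : ℝ) ≤ (j : ℝ) / N := by positivity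
  have hk : (0 : ℝ) ≤ (k : ℝ) / N := by positivity
  exact mapToPoincare_strictMonoOn.monotoneOn (radialQuantile_nonneg hα hR hj)
    (radialQuantile_nonneg hα hR hk) ((radialQuantile_strictMonoOn hα hR).monotoneOn hj hk h)

lemma gridCell_minE_le (hα : 0 < α) (hR : 0 < R) (N i j : ℕ) :
    (gridCell α R N i j).minE ≤ (gridCell α R N i j).maxE := by
  rw [gridCell_maxE]
  exact monotone_grid_radius hα hR N (Nat.le_succ j)

lemma gridCell_minφ_le (N i j : ℕ) : (gridCell α R N i j).minφ ≤ (gridCell α R N i j).maxφ :=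
  Set.nonempty_Icc.1 (column_nonempty N i)

lemma gridCell_minφ_nonneg (N i j : ℕ) : 0 ≤ (gridCell α R N i j).minφ := by
  simp only [gridCell]
  positivity

lemma gridCell_maxφ_le {N i : ℕ} (hi : i < N) (j : ℕ) :
    (gridCell α R N i j).maxφ ≤ 2 * Real.pi := by
  refine mul_le_of_le_one_right (by positivity) ?_
  rw [div_le_one (by exact_mod_cast (Nat.zero_le i).trans_lt hi)]
  exact_mod_cast hi

lemma Cell.Contains.covers (hα : 0 < α) (hR : 0 < R) {N i j : ℕ} {p : ℝ × ℝ}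
    (h : (gridCell α R N i j).Contains p) :
    (gridCell α R N i j).Covers p.1 (mapToPoincare p.2) := by
  obtain ⟨⟨h1, h2⟩, h3, h4⟩ := h
  have h5 : 0 ≤ (gridCell α R N i j).minH := radialQuantile_nonneg hα hR (by positivity)
  exact ⟨⟨h1, h2.le⟩, mapToPoincare_strictMonoOn.monotoneOn h5 (h5.trans h3) h3,
    mapToPoincare_strictMonoOn.monotoneOn (h5.trans h3) (h5.trans (h3.trans h4.le)) h4.le⟩

/-- The quadrant test compares radii in the disk whereas cells are native; strict monotonicity of
`mapToPoincare` makes the two tests agree. -/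
lemma quadrant_eq_iff (hα : 0 < α) (hR : 0 < R) {V : Type} (v : V) {N i j : ℕ} {p : ℝ × ℝ}
    (h : (gridCell α R N i j).Contains p) (q : Bool × Bool) :
    (gridCell α R N i j).quadrant α ⟨v, p.1, mapToPoincare p.2⟩ = q ↔
      (gridCell α R (2 * N) (2 * i + q.1.toNat) (2 * j + q.2.toNat)).Contains p := by
  rw [← gridCell_sub hα hR]
  obtain ⟨⟨h1, h2⟩, h3, h4⟩ := h
  have h5 : 0 ≤ (gridCell α R N i j).minH := radialQuantile_nonneg hα hR (by positivity)
  have h6 : 0 ≤ (gridCell α R N i j).midH α := by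
    rw [gridCell_midH hα hR]
    exact radialQuantile_nonneg hα hR (by positivity)
  have h7 : (gridCell α R N i j).midE α ≤ mapToPoincare p.2 ↔
      (gridCell α R N i j).midH α ≤ p.2 :=
    mapToPoincare_strictMonoOn.le_iff_le h6 (h5.trans h3)
  obtain ⟨a, b⟩ := q
  simp only [Cell.quadrant, h7, Prod.mk.injEq, Cell.Contains, Cell.sub]
  cases a <;> cases b <;> simp [h1, h2, h3, h4]

lemma index_eq_of_mem {f : ℝ → ℝ} (hf : StrictMonoOn f (Set.Ici 0)) {N i j : ℕ} {y : ℝ}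
    (hi : f (i / N) ≤ y) (hi' : y < f ((i + 1) / N)) (hj : f (j / N) ≤ y)
    (hj' : y < f ((j + 1) / N)) : i = j := by
  have key : ∀ a b : ℕ, f (a / N) ≤ y → y < f ((b + 1) / N) → a ≤ b := by
    intro a b ha hb
    by_contra! hab
    have h2 : ((b : ℝ) + 1) / N ≤ a / N := by
      gcongr
      exact_mod_cast hab
    exact absurd (hf.monotoneOn (Set.mem_Ici.2 (by positivity)) (Set.mem_Ici.2 (by positivity)) h2)
      (not_le.2 (ha.trans_lt hb))
  exact le_antisymm (key i j hi hj') (key j i hj hi')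

lemma angle_strictMonoOn : StrictMonoOn (fun u : ℝ => 2 * Real.pi * u) (Set.Ici 0) :=
  fun _ _ _ _ h => mul_lt_mul_of_pos_left h Real.two_pi_pos

lemma gridCell_index_eq (hα : 0 < α) (hR : 0 < R) {N i j i' j' : ℕ} {p : ℝ × ℝ}
    (h : (gridCell α R N i j).Contains p) (h' : (gridCell α R N i' j').Contains p) :
    i = i' ∧ j = j' :=
  ⟨index_eq_of_mem angle_strictMonoOn h.1.1 h.1.2 h'.1.1 h'.1.2,
    index_eq_of_mem (radialQuantile_strictMonoOn hα hR) h.2.1 h.2.2 h'.2.1 h'.2.2⟩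

lemma ancestor_bounds (N M i : ℕ) (hM : 0 < M) :
    (((i / M : ℕ) : ℝ) / N ≤ i / (N * M : ℕ)) ∧
      ((i : ℝ) + 1) / (N * M : ℕ) ≤ ((i / M : ℕ) + 1) / N := by
  have hM' : (0 : ℝ) < M := by exact_mod_cast hM
  have h1 : ((i / M : ℕ) : ℝ) * M ≤ i := by exact_mod_cast Nat.div_mul_le_self i M
  have h2 : (i : ℝ) + 1 ≤ ((i / M : ℕ) + 1) * M := by
    exact_mod_cast Nat.lt_mul_of_div_lt (Nat.lt_succ_self (i / M)) hM
  rw [Nat.cast_mul]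
  rw [← mul_div_mul_right ((i / M : ℕ) : ℝ) _ hM'.ne',
    ← mul_div_mul_right (((i / M : ℕ) : ℝ) + 1) _ hM'.ne']
  exact ⟨by gcongr, by gcongr⟩

lemma gridCell_ancestor (hα : 0 < α) (hR : 0 < R) (N M i j : ℕ) (hM : 0 < M) :
    ((gridCell α R N (i / M) (j / M)).minφ ≤ (gridCell α R (N * M) i j).minφ ∧
      (gridCell α R (N * M) i j).maxφ ≤ (gridCell α R N (i / M) (j / M)).maxφ) ∧
    (gridCell α R N (i / M) (j / M)).minH ≤ (gridCell α R (N * M) i j).minH ∧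
      (gridCell α R (N * M) i j).maxH ≤ (gridCell α R N (i / M) (j / M)).maxH := by
  obtain ⟨h1, h2⟩ := ancestor_bounds N M i hM
  obtain ⟨h3, h4⟩ := ancestor_bounds N M j hM
  have hp := Real.two_pi_pos
  have hm := (radialQuantile_strictMonoOn hα hR).monotoneOn
  exact ⟨⟨mul_le_mul_of_nonneg_left h1 hp.le, mul_le_mul_of_nonneg_left h2 hp.le⟩,
    hm (Set.mem_Ici.2 (by positivity)) (Set.mem_Ici.2 (by positivity)) h3,
    hm (Set.mem_Ici.2 (by positivity)) (Set.mem_Ici.2 (by positivity)) h4⟩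

lemma Cell.Contains.ancestor (hα : 0 < α) (hR : 0 < R) {N M i j : ℕ} (hM : 0 < M) {p : ℝ × ℝ}
    (h : (gridCell α R (N * M) i j).Contains p) :
    (gridCell α R N (i / M) (j / M)).Contains p := by
  obtain ⟨⟨h1, h2⟩, h3, h4⟩ := gridCell_ancestor hα hR N M i j hM
  exact ⟨⟨h1.trans h.1.1, h.1.2.trans_le h2⟩, h3.trans h.2.1, h.2.2.trans_le h4⟩

lemma Cell.Covers.ancestor (hα : 0 < α) (hR : 0 < R) {N M i j : ℕ} (hM : 0 < M) {φ r : ℝ}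
    (h : (gridCell α R (N * M) i j).Covers φ r) :
    (gridCell α R N (i / M) (j / M)).Covers φ r := by
  obtain ⟨⟨h1, h2⟩, h3, h4⟩ := gridCell_ancestor hα hR N M i j hM
  have hm := mapToPoincare_strictMonoOn.monotoneOn
  have e1 : 0 ≤ (gridCell α R N (i / M) (j / M)).minH :=
    radialQuantile_nonneg hα hR (by positivity)
  have e2 : 0 ≤ (gridCell α R (N * M) i j).maxH := radialQuantile_nonneg hα hR (by positivity)
  exact ⟨⟨h1.trans h.1.1, h.1.2.trans h2⟩, (hm e1 (e1.trans h3) h3).trans h.2.1,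
    h.2.2.trans (hm e2 (e2.trans h4) h4)⟩

/-- Both witnesses persist in the larger cell. This is what lets deep levels be charged to one fixed
level. -/
lemma Cell.Straddles.ancestor (hα : 0 < α) (hR : 0 < R) {N M i j : ℕ} (hM : 0 < M) {Q : Circle}
    (h : (gridCell α R (N * M) i j).Straddles Q) :
    (gridCell α R N (i / M) (j / M)).Straddles Q := by
  obtain ⟨⟨φ, r, h1, h2⟩, φ', r', h3, h4⟩ := h
  exact ⟨⟨φ, r, h1.ancestor hα hR hM, h2⟩, φ', r', h3.ancestor hα hR hM, h4⟩

open Classical in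
-- Star-shapedness moves the inside witness to the inner arc of the cell and the outside witness to
-- the outer arc.
lemma card_straddling_cells_le (hα : 0 < α) (hR : 0 < R) {Q : Circle} (hQ : Q.Central) {N : ℕ}
    (hN : 0 < N) : ((Finset.range N ×ˢ Finset.range N).filter fun ij : ℕ × ℕ =>
      (gridCell α R N ij.1 ij.2).Straddles Q).card ≤ 9 * N := by
  refine le_trans (Finset.card_le_card fun ij h => ?_) (card_boundary_cells_le hQ hN
    (monotone_grid_radius hα hR N) (mapToPoincare_nonneg _))
  obtain ⟨h0, ⟨φ, r, ⟨h1, h2, h3⟩, h4⟩, φ', r', ⟨h5, h6, h7⟩, h8⟩ := Finset.mem_filter.1 h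
  rw [gridCell_maxE] at h7
  exact Finset.mem_filter.2 ⟨h0, ⟨φ, h1, h4.anti hQ (mapToPoincare_nonneg _) h2⟩, φ', h5,
    fun hcon => h8 (hcon.anti hQ ((gridCell_minE_nonneg _ _ _).trans h6) h7)⟩

end Grid

/-! Timed computations -/

lemma returns_pure {β : Type} (b : β) : (pure b : Timed β).Returns b 0 := rfl

lemma returns_tick (k : ℕ) : (tick k).Returns () k := rfl

lemma Timed.Returns.bind {β γ : Type} {c : Timed β} {f : β → Timed γ} {b : β} {r : γ} {s t : ℕ}
    (hc : c.Returns b s) (hf : (f b).Returns r t) : (c >>= f).Returns r (s + t) := by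
  unfold Timed.Returns at *
  subst hc
  change Option.map _ (f b) = _
  rw [hf]
  rfl

lemma returns_splitLeaf {V : Type} (α : ℝ) (c : Cell) (pts : List (Item V)) :
    (splitLeaf α c pts).Returns
      (.node c fun q => .leaf (c.sub α q) (pts.filter fun p => c.quadrant α p = q))
      (4 * (pts.length + 1) + 0) :=
  (returns_tick _).bind (returns_pure _)

/-! The quadtree -/

/-- The record stored for the vertex `v` at position `x v`. -/
def item {V : Type} (x : V → ℝ × ℝ) (v : V) : Item V := ⟨v, (x v).1, mapToPoincare (x v).2⟩

/-- `T` is a quadtree for the cell in column `i` and row `j` of the `N × N` grid storing exactly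
the vertices in `S`; its inner nodes are responsible for more than `cap` vertices. -/
def Stores {V : Type} [DecidableEq V] (α R : ℝ) (cap : ℕ) (x : V → ℝ × ℝ) :
    QuadTree V → ℕ → ℕ → ℕ → Finset V → Prop
  | .leaf c pts, N, i, j, S => c = gridCell α R N i j ∧ pts.length ≤ cap ∧
      ∃ l : List V, pts = l.map (item x) ∧ l.Nodup ∧ l.toFinset = S
  | .node c child, N, i, j, S => c = gridCell α R N i j ∧ cap < S.card ∧
      ∀ q : Bool × Bool, Stores α R cap x (child q) (2 * N) (2 * i + q.1.toNat)
        (2 * j + q.2.toNat) (S.filter fun v => c.quadrant α (item x v) = q)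

/-- No two points lie in the same cell of the `N × N` grid. -/
def Separated {V : Type} (α R : ℝ) (x : V → ℝ × ℝ) (N : ℕ) : Prop :=
  ∀ v w i j, (gridCell α R N i j).Contains (x v) → (gridCell α R N i j).Contains (x w) → v = w

section Insertion

variable {V : Type} {α R : ℝ} {cap : ℕ} {x : V → ℝ × ℝ}

lemma Separated.card_le_one {N i j : ℕ} (h : Separated α R x N) {S : Finset V}
    (hS : ∀ v ∈ S, (gridCell α R N i j).Contains (x v)) : S.card ≤ 1 :=
  Finset.card_le_one.2 fun v hv w hw => h v w i j (hS v hv) (hS w hw)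

lemma contains_child (hα : 0 < α) (hR : 0 < R) {N i j : ℕ} {S : Finset V}
    (hS : ∀ v ∈ S, (gridCell α R N i j).Contains (x v)) (q : Bool × Bool) :
    ∀ v ∈ S.filter fun v => (gridCell α R N i j).quadrant α (item x v) = q,
      (gridCell α R (2 * N) (2 * i + q.1.toNat) (2 * j + q.2.toNat)).Contains (x v) := by
  intro v hv
  obtain ⟨h1, h2⟩ := Finset.mem_filter.1 hv
  exact (quadrant_eq_iff hα hR v (hS v h1) q).1 h2

variable [DecidableEq V]

/-- Insertion below an inner node, provided that insertion into its children works. -/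
lemma insert_node {k B N i j : ℕ} {S : Finset V} {p : V} {child : Bool × Bool → QuadTree V}
    (hchild : ∀ q : Bool × Bool, Stores α R cap x (child q) (2 * N) (2 * i + q.1.toNat)
      (2 * j + q.2.toNat) (S.filter fun v => (gridCell α R N i j).quadrant α (item x v) = q))
    (hcard : cap < (Insert.insert p S).card)
    (ih : ∀ q, (gridCell α R N i j).quadrant α (item x p) = q → ∃ T' t,
      (∀ d, k ≤ d → (RHG.insert α cap d (child q) (item x p)).Returns T' t) ∧
      Stores α R cap x T' (2 * N) (2 * i + q.1.toNat) (2 * j + q.2.toNat) (Insert.insert p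
        (S.filter fun v => (gridCell α R N i j).quadrant α (item x v) = q)) ∧ t ≤ B) :
    ∃ T' t, (∀ d, k + 1 ≤ d →
        (RHG.insert α cap d (.node (gridCell α R N i j) child) (item x p)).Returns T' t) ∧
      Stores α R cap x T' N i j (Insert.insert p S) ∧ t ≤ B + 1 := by
  set q₀ := (gridCell α R N i j).quadrant α (item x p) with hq₀
  obtain ⟨T', t, h1, h2, h3⟩ := ih q₀ rfl
  refine ⟨.node (gridCell α R N i j) (Function.update child q₀ T'), 1 + (t + 0), ?_, ?_, by omega⟩
  · intro d hd
    obtain ⟨d, rfl⟩ : ∃ e, d = e + 1 := ⟨d - 1, by omega⟩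
    rw [RHG.insert]
    exact (returns_tick 1).bind ((h1 d (by omega)).bind (returns_pure _))
  · refine ⟨rfl, hcard, fun q => ?_⟩
    rcases eq_or_ne q q₀ with rfl | hq
    · rw [Function.update_self, Finset.filter_insert, if_pos hq₀.symm]
      exact h2
    · rw [Function.update_of_ne hq, Finset.filter_insert, if_neg (fun h => hq h.symm)]
      exact hchild q

/-- Here `k` is the number of levels down to a grid that separates the points. One level uses up to
two units of recursion depth, a split and a descent, whence `2 * k + 1`. It costs up to `cap + 1`
for the full leaf, `4 * (cap + 1)` for the split and `1` for the descent. -/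
theorem insert_stores (hα : 0 < α) (hR : 0 < R) (hcap : 1 ≤ cap) (k : ℕ) :
    ∀ (T : QuadTree V) (N i j : ℕ) (S : Finset V) (p : V), Separated α R x (N * 2 ^ k) →
      Stores α R cap x T N i j S → p ∉ S →
      (∀ v ∈ Insert.insert p S, (gridCell α R N i j).Contains (x v)) →
      ∃ T' t, (∀ d, 2 * k + 1 ≤ d → (RHG.insert α cap d T (item x p)).Returns T' t) ∧
        Stores α R cap x T' N i j (Insert.insert p S) ∧ t ≤ (k + 1) * (5 * (cap + 1) + 1) := by
  have leaf_case : ∀ (k : ℕ) (pts : List (Item V)) (N i j : ℕ) (S : Finset V) (p : V),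
      Stores α R cap x (.leaf (gridCell α R N i j) pts) N i j S → p ∉ S → pts.length < cap →
      ∃ T' t, (∀ d, k + 1 ≤ d → (RHG.insert α cap d (.leaf (gridCell α R N i j) pts)
          (item x p)).Returns T' t) ∧
        Stores α R cap x T' N i j (Insert.insert p S) ∧ t ≤ cap + 1 := by
    rintro k pts N i j S p ⟨-, hlen, l, rfl, hl, rfl⟩ hp hlt
    refine ⟨.leaf (gridCell α R N i j) (item x p :: l.map (item x)),
      (l.map (item x)).length + 1 + 0, ?_, ?_, by omega⟩
    · intro d hd
      obtain ⟨d, rfl⟩ : ∃ e, d = e + 1 := ⟨d - 1, by omega⟩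
      rw [RHG.insert, if_pos hlt]
      exact (returns_tick _).bind (returns_pure _)
    · refine ⟨rfl, hlt, p :: l, rfl, List.nodup_cons.2 ⟨by simpa using hp, hl⟩, by simp⟩
  induction k with
  | zero =>
    intro T N i j S p hsep hT hp hS
    -- The cell itself is separated, so `S` is empty; the tree is then a leaf, and it has room
    -- because `cap ≥ 1`.
    rw [pow_zero, mul_one] at hsep
    have hcard := hsep.card_le_one hS
    rw [Finset.card_insert_of_notMem hp] at hcard
    cases T with
    | leaf c pts =>
      obtain ⟨rfl, hlen, l, rfl, hl, rfl⟩ := hT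
      rw [List.toFinset_card_of_nodup hl] at hcard
      obtain ⟨T', t, h1, h2, h3⟩ := leaf_case 0 (l.map (item x)) N i j l.toFinset p
        ⟨rfl, hlen, l, rfl, hl, rfl⟩ hp (by rw [List.length_map]; omega)
      exact ⟨T', t, h1, h2, by omega⟩
    | node c child =>
      have := hT.2.1
      omega
  | succ k ih =>
    intro T N i j S p hsep hT hp hS
    have hsep' : Separated α R x (2 * N * 2 ^ k) := by
      rwa [pow_succ', mul_left_comm, ← mul_assoc] at hsep
    have hstep : ∀ child : Bool × Bool → QuadTree V,
        (∀ q : Bool × Bool, Stores α R cap x (child q) (2 * N) (2 * i + q.1.toNat)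
          (2 * j + q.2.toNat)
          (S.filter fun v => (gridCell α R N i j).quadrant α (item x v) = q)) →
        cap < (Insert.insert p S).card →
        ∃ T' t, (∀ d, 2 * k + 1 + 1 ≤ d →
          (RHG.insert α cap d (.node (gridCell α R N i j) child) (item x p)).Returns T' t) ∧
          Stores α R cap x T' N i j (Insert.insert p S) ∧
          t ≤ (k + 1) * (5 * (cap + 1) + 1) + 1 := by
      intro child hchild hcard
      refine insert_node hchild hcard fun q hq => ih _ _ _ _ _ _ hsep' (hchild q)
        (fun h => hp (Finset.mem_filter.1 h).1) ?_
      have := contains_child hα hR hS q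
      rwa [Finset.filter_insert, if_pos hq] at this
    have hB : (k + 1 + 1) * (5 * (cap + 1) + 1) =
      (k + 1) * (5 * (cap + 1) + 1) + (5 * (cap + 1) + 1) := by ring
    cases T with
    | leaf c pts =>
      obtain ⟨rfl, hlen, hl⟩ := hT
      by_cases hlt : pts.length < cap
      · obtain ⟨T', t, h1, h2, h3⟩ := leaf_case 0 pts N i j S p ⟨rfl, hlen, hl⟩ hp hlt
        exact ⟨T', t, fun d hd => h1 d (by omega), h2, by rw [hB]; omega⟩
      · obtain ⟨l, rfl, hnd, hlS⟩ := hl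
        have hSc : S.card = (l.map (item x)).length := by
          rw [← hlS, List.toFinset_card_of_nodup hnd, List.length_map]
        obtain ⟨T', t, h1, h2, h3⟩ := hstep
          (fun q => .leaf ((gridCell α R N i j).sub α q)
            ((l.map (item x)).filter fun p => (gridCell α R N i j).quadrant α p = q))
          (fun q => ⟨gridCell_sub hα hR N i j q, (List.length_filter_le _ _).trans hlen,
            l.filter fun v => (gridCell α R N i j).quadrant α (item x v) = q,
            List.filter_map, hnd.filter _, by
              rw [List.toFinset_filter, hlS]
              simp⟩)
          (by rw [Finset.card_insert_of_notMem hp]; omega)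
        refine ⟨T', (l.map (item x)).length + 1 + (4 * ((l.map (item x)).length + 1) + 0 + t), ?_,
          h2, by rw [hB]; omega⟩
        intro d hd
        obtain ⟨d, rfl⟩ : ∃ e, d = e + 1 := ⟨d - 1, by omega⟩
        rw [RHG.insert, if_neg hlt]
        exact (returns_tick _).bind ((returns_splitLeaf _ _ _).bind (h1 d (by omega)))
    | node c child =>
      obtain ⟨rfl, hcard, hchild⟩ := hT
      obtain ⟨T', t, h1, h2, h3⟩ := hstep child hchild
        (hcard.trans_le (Finset.card_le_card (Finset.subset_insert _ _)))
      exact ⟨T', t, fun d hd => h1 d (by omega), h2, by rw [hB]; omega⟩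

theorem insertLoop_stores (hα : 0 < α) (hR : 0 < R) (hcap : 1 ≤ cap) {k : ℕ}
    (hsep : Separated α R x (2 ^ k)) (hx : ∀ v, (gridCell α R 1 0 0).Contains (x v)) :
    ∀ (vs : List V) (T : QuadTree V) (S : Finset V), Stores α R cap x T 1 0 0 S → vs.Nodup →
      (∀ v ∈ vs, v ∉ S) →
      ∃ T' t, (∀ d, 2 * k + 1 ≤ d → (insertLoop α cap d x vs T).Returns T' t) ∧
        Stores α R cap x T' 1 0 0 (vs.toFinset ∪ S) ∧
        t ≤ vs.length * ((k + 1) * (5 * (cap + 1) + 1) + 1) := by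
  intro vs
  induction vs with
  | nil => exact fun T S hT _ _ => ⟨T, 0, fun _ _ => rfl, by simpa using hT, by simp⟩
  | cons v vs ih =>
    intro T S hT hnd hdisj
    obtain ⟨hv, hnd⟩ := List.nodup_cons.1 hnd
    obtain ⟨T₁, t₁, h1, h2, h3⟩ := insert_stores hα hR hcap k T 1 0 0 S v (by rwa [one_mul]) hT
      (hdisj v List.mem_cons_self) (fun w _ => hx w)
    obtain ⟨T₂, t₂, h4, h5, h6⟩ := ih T₁ (Insert.insert v S) h2 hnd (by
      intro w hw hcon
      rcases Finset.mem_insert.1 hcon with rfl | hcon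
      · exact hv hw
      · exact hdisj w (List.mem_cons_of_mem _ hw) hcon)
    refine ⟨T₂, 1 + (t₁ + t₂), fun d hd => ?_, ?_, ?_⟩
    · rw [insertLoop]
      exact (returns_tick 1).bind ((h1 d hd).bind (h4 d hd))
    · rwa [List.toFinset_cons, Finset.insert_union, ← Finset.union_insert]
    · rw [List.length_cons, add_one_mul]
      omega

end Insertion

/-! Range queries -/

/-- The vertex `v` at position `x v` lies inside the circle. -/
def Hits {V : Type} (Q : Circle) (x : V → ℝ × ℝ) (v : V) : Prop :=
  Q.Inside (x v).1 (mapToPoincare (x v).2)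

/-- The sum of `w` over the descendants of a grid cell in the next `k` levels, itself included. -/
def treeSum (w : ℕ → ℕ → ℕ → ℕ) : ℕ → ℕ → ℕ → ℕ → ℕ
  | 0, _, _, _ => 0
  | k + 1, N, i, j => w N i j +
      (treeSum w k (2 * N) (2 * i) (2 * j) + treeSum w k (2 * N) (2 * i) (2 * j + 1) +
        treeSum w k (2 * N) (2 * i + 1) (2 * j) + treeSum w k (2 * N) (2 * i + 1) (2 * j + 1))

lemma sum_range_two_mul (f : ℕ → ℕ) (N : ℕ) :
    ∑ i ∈ Finset.range (2 * N), f i = ∑ i ∈ Finset.range N, (f (2 * i) + f (2 * i + 1)) := by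
  induction N with
  | zero => rfl
  | succ N ih =>
    rw [mul_add_one, Finset.sum_range_succ, Finset.sum_range_succ, Finset.sum_range_succ, ih]
    ring

/-- Summing over the tree becomes summing over whole grids, level by level. -/
lemma sum_treeSum (w : ℕ → ℕ → ℕ → ℕ) (k : ℕ) : ∀ N : ℕ,
    ∑ i ∈ Finset.range N, ∑ j ∈ Finset.range N, treeSum w k N i j =
      ∑ l ∈ Finset.range k, ∑ i ∈ Finset.range (2 ^ l * N), ∑ j ∈ Finset.range (2 ^ l * N),
        w (2 ^ l * N) i j := by
  induction k with
  | zero => simp [treeSum]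
  | succ k ih =>
    intro N
    have h : ∀ l, 2 ^ (l + 1) * N = 2 ^ l * (2 * N) := fun l => by ring
    rw [Finset.sum_range_succ', pow_zero, one_mul]
    simp only [h]
    rw [← ih (2 * N), sum_range_two_mul]
    have hrec : ∀ i j, treeSum w (k + 1) N i j = w N i j +
      (treeSum w k (2 * N) (2 * i) (2 * j) + treeSum w k (2 * N) (2 * i) (2 * j + 1) +
        treeSum w k (2 * N) (2 * i + 1) (2 * j) + treeSum w k (2 * N) (2 * i + 1) (2 * j + 1)) :=
      fun _ _ => rfl
    simp only [hrec, sum_range_two_mul, Finset.sum_add_distrib]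
    ring

open Classical in
/-- Indicator of the cells whose nodes are inner nodes that a query for `Q` expands. -/
def expanded {V : Type} [Fintype V] (α R : ℝ) (cap : ℕ) (x : V → ℝ × ℝ) (Q : Circle)
    (N i j : ℕ) : ℕ :=
  if cap < (Finset.univ.filter fun v => (gridCell α R N i j).Contains (x v)).card ∧
    (gridCell α R N i j).Meets Q then 1 else 0

section Query

variable {V : Type} {α R : ℝ} {cap : ℕ} {x : V → ℝ × ℝ} {Q : Circle}

open Classical in
lemma scan_returns [DecidableEq V] (l : List V) : ∀ acc : List V, l.Nodup → ∃ res,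
    (scan Q (l.map (item x)) acc).Returns res l.length ∧
    (∀ w, w ∈ res ↔ w ∈ acc ∨ (w ∈ l.toFinset ∧ Hits Q x w)) ∧
    res.length = acc.length + (l.toFinset.filter (Hits Q x)).card := by
  induction l with
  | nil => exact fun acc _ => ⟨acc, rfl, by simp, by simp⟩
  | cons v l ih =>
    intro acc hnd
    obtain ⟨hv, hnd⟩ := List.nodup_cons.1 hnd
    by_cases h : Hits Q x v
    · obtain ⟨res, h1, h2, h3⟩ := ih (v :: acc) hnd
      refine ⟨res, ?_, fun w => ?_, ?_⟩
      · rw [List.map_cons, scan, List.length_cons, add_comm]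
        refine (returns_tick 1).bind ?_
        rw [if_pos (show polarDist (item x v).φ (item x v).r Q.φ Q.r < Q.rad from h)]
        exact h1
      · rw [h2, List.mem_cons, List.toFinset_cons, Finset.mem_insert]
        constructor
        · rintro ((rfl | h') | h')
          · exact Or.inr ⟨Or.inl rfl, h⟩
          · exact Or.inl h'
          · exact Or.inr ⟨Or.inr h'.1, h'.2⟩
        · rintro (h' | ⟨rfl | h', h''⟩)
          · exact Or.inl (Or.inr h')
          · exact Or.inl (Or.inl rfl)
          · exact Or.inr ⟨h', h''⟩
      · rw [h3, List.toFinset_cons, Finset.filter_insert, if_pos h,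
          Finset.card_insert_of_notMem (by simp [hv]), List.length_cons]
        ring
    · obtain ⟨res, h1, h2, h3⟩ := ih acc hnd
      refine ⟨res, ?_, fun w => ?_, ?_⟩
      · rw [List.map_cons, scan, List.length_cons, add_comm]
        refine (returns_tick 1).bind ?_
        rw [if_neg (show ¬ polarDist (item x v).φ (item x v).r Q.φ Q.r < Q.rad from h)]
        exact h1
      · rw [h2, List.toFinset_cons, Finset.mem_insert]
        constructor
        · rintro (h' | h')
          · exact Or.inl h'
          · exact Or.inr ⟨Or.inr h'.1, h'.2⟩
        · rintro (h' | ⟨rfl | h', h''⟩)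
          · exact Or.inl h'
          · exact absurd h'' h
          · exact Or.inr ⟨h', h''⟩
      · rw [h3, List.toFinset_cons, Finset.filter_insert, if_neg h]

lemma not_hits_of_rad_le (hα : 0 < α) (hR : 0 < R) (hQ : Q.Central) {N i j : ℕ} (hi : i < N)
    (h : Q.rad ≤ (gridCell α R N i j).dist Q) {v : V}
    (hv : (gridCell α R N i j).Contains (x v)) : ¬ Hits Q x v := fun hit =>
  absurd (h.trans (Cell.dist_le hQ (gridCell_minE_nonneg _ _ _) (gridCell_minφ_nonneg _ _ _)
    (gridCell_maxφ_le hi j) (hv.covers hα hR))) (not_le.2 hit)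

open Classical in
-- A call at a leaf or a pruned node costs at most `cap + 1`. An expanded node pays `1` for itself
-- and reserves `cap + 1` for each of its four children. The exact length of the result excludes
-- repetitions, so the later output work is bounded by the number of hits.
theorem query_returns [Fintype V] [DecidableEq V] (hα : 0 < α) (hR : 0 < R) (hcap : 1 ≤ cap) (hQ : Q.Central)
    (k : ℕ) : ∀ (T : QuadTree V) (N i j : ℕ) (S : Finset V) (acc : List V), i < N →
      Separated α R x (N * 2 ^ k) → Stores α R cap x T N i j S →
      (∀ v ∈ S, (gridCell α R N i j).Contains (x v)) →
      ∃ res t, (verticesInCircle Q T acc).Returns res t ∧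
        (∀ w, w ∈ res ↔ w ∈ acc ∨ (w ∈ S ∧ Hits Q x w)) ∧
        res.length = acc.length + (S.filter (Hits Q x)).card ∧
        t ≤ (cap + 1) + (4 * (cap + 1) + 1) * treeSum (expanded α R cap x Q) k N i j := by
  have pruned : ∀ {N i j : ℕ} {S : Finset V} (acc : List V), i < N →
      (∀ v ∈ S, (gridCell α R N i j).Contains (x v)) → Q.rad ≤ (gridCell α R N i j).dist Q →
      (∀ w, w ∈ acc ↔ w ∈ acc ∨ (w ∈ S ∧ Hits Q x w)) ∧
        acc.length = acc.length + (S.filter (Hits Q x)).card := by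
    intro N i j S acc hi hS hd
    have hno := fun v hv => not_hits_of_rad_le hα hR hQ hi hd (hS v hv)
    refine ⟨fun w => ⟨Or.inl, fun h => h.resolve_right fun h' => hno w h'.1 h'.2⟩, ?_⟩
    rw [Finset.filter_false_of_mem hno, Finset.card_empty, add_zero]
  have leaf_case : ∀ (B : ℕ) (pts : List (Item V)) (N i j : ℕ) (S : Finset V) (acc : List V),
      i < N → Stores α R cap x (.leaf (gridCell α R N i j) pts) N i j S →
      (∀ v ∈ S, (gridCell α R N i j).Contains (x v)) →
      ∃ res t, (verticesInCircle Q (.leaf (gridCell α R N i j) pts) acc).Returns res t ∧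
        (∀ w, w ∈ res ↔ w ∈ acc ∨ (w ∈ S ∧ Hits Q x w)) ∧
        res.length = acc.length + (S.filter (Hits Q x)).card ∧ t ≤ (cap + 1) + B := by
    rintro B pts N i j S acc hi ⟨-, hlen, l, rfl, hl, rfl⟩ hS
    rw [List.length_map] at hlen
    by_cases hd : Q.rad ≤ (gridCell α R N i j).dist Q
    · refine ⟨acc, 1 + 0, ?_, (pruned acc hi (S := l.toFinset) hS hd).1,
        (pruned acc hi hS hd).2, by omega⟩
      rw [verticesInCircle, if_pos hd]
      exact (returns_tick 1).bind (returns_pure _)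
    · obtain ⟨res, h1, h2, h3⟩ := scan_returns (Q := Q) (x := x) l acc hl
      refine ⟨res, 1 + l.length, ?_, h2, h3, by omega⟩
      rw [verticesInCircle, if_neg hd]
      exact (returns_tick 1).bind h1
  induction k with
  | zero =>
    intro T N i j S acc hi hsep hT hS
    rw [pow_zero, mul_one] at hsep
    cases T with
    | leaf c pts =>
      obtain ⟨rfl, hl⟩ := hT
      exact leaf_case _ pts N i j S acc hi ⟨rfl, hl⟩ hS
    | node c child =>
      have := hT.2.1
      have := hsep.card_le_one hS
      omega
  | succ k ih =>
    intro T N i j S acc hi hsep hT hS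
    have hsep' : Separated α R x (2 * N * 2 ^ k) := by
      rwa [pow_succ', mul_left_comm, ← mul_assoc] at hsep
    cases T with
    | leaf c pts =>
      obtain ⟨rfl, hl⟩ := hT
      exact leaf_case _ pts N i j S acc hi ⟨rfl, hl⟩ hS
    | node c child =>
      obtain ⟨rfl, hcard, hchild⟩ := hT
      by_cases hd : Q.rad ≤ (gridCell α R N i j).dist Q
      · refine ⟨acc, 1 + 0, ?_, (pruned acc hi hS hd).1, (pruned acc hi hS hd).2, by omega⟩
        rw [verticesInCircle, if_pos hd]
        exact (returns_tick 1).bind (returns_pure _)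
      · have hw : expanded α R cap x Q N i j = 1 := by
          refine if_pos ⟨hcard.trans_le (Finset.card_le_card fun v hv =>
            Finset.mem_filter.2 ⟨Finset.mem_univ v, hS v hv⟩), ?_⟩
          exact Cell.meets_of_dist_lt (gridCell_minE_le hα hR N i j) (gridCell_minφ_le N i j)
            (not_le.1 hd)
        have step := fun (q : Bool × Bool) (acc : List V) =>
          ih (child q) (2 * N) (2 * i + q.1.toNat) (2 * j + q.2.toNat) _ acc
            (by have := Bool.toNat_le q.1; omega) hsep' (hchild q) (contains_child hα hR hS q)
        obtain ⟨r₁, t₁, a1, a2, a3, a4⟩ := step (false, false) acc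
        obtain ⟨r₂, t₂, b1, b2, b3, b4⟩ := step (false, true) r₁
        obtain ⟨r₃, t₃, c1, c2, c3, c4⟩ := step (true, false) r₂
        obtain ⟨r₄, t₄, d1, d2, d3, d4⟩ := step (true, true) r₃
        refine ⟨r₄, 1 + (t₁ + (t₂ + (t₃ + t₄))), ?_, fun w => ?_, ?_, ?_⟩
        · rw [verticesInCircle, if_neg hd]
          exact (returns_tick 1).bind (a1.bind (b1.bind (c1.bind d1)))
        · rw [d2, c2, b2, a2]
          simp only [Finset.mem_filter]
          rcases h : (gridCell α R N i j).quadrant α (item x w) with ⟨_ | _, _ | _⟩ <;> simp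
        -- The hits in `S` are partitioned by the quadrant they fall into.
        · rw [d3, c3, b3, a3, Finset.card_eq_sum_card_fiberwise (s := S.filter (Hits Q x))
            (f := fun v => (gridCell α R N i j).quadrant α (item x v)) (t := Finset.univ)
            (fun _ _ => Finset.mem_coe.2 (Finset.mem_univ _)), Fintype.sum_prod_type]
          simp only [Fintype.sum_bool, Finset.filter_filter, and_comm (a := Hits Q x _)]
          ring
        · simp only [Bool.toNat_false, Bool.toNat_true, add_zero] at a4 b4 c4 d4
          rw [treeSum, hw, mul_add (_ + 1) 1, mul_add (_ + 1), mul_add (_ + 1), mul_add (_ + 1)]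
          omega

end Query

section EdgeLoop

variable {V : Type} [DecidableEq V]

lemma addEdges_returns (v : V) (ws : List V) : ∀ E : List (V × V), ∃ E',
    (addEdges v ws E).Returns E' ws.length ∧
    ∀ a b, (a, b) ∈ E' ↔ (a, b) ∈ E ∨ (a = v ∧ b ∈ ws ∧ b ≠ v) := by
  induction ws with
  | nil => exact fun E => ⟨E, rfl, by simp⟩
  | cons w ws ih =>
    intro E
    obtain ⟨E', h1, h2⟩ := ih (if w = v then E else (v, w) :: E)
    refine ⟨E', ?_, fun a b => ?_⟩
    · rw [addEdges, List.length_cons, add_comm]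
      exact (returns_tick 1).bind h1
    · rw [h2]
      by_cases hw : w = v
      · rw [if_pos hw]
        aesop
      · rw [if_neg hw]
        aesop

variable [Fintype V] {α R : ℝ} {cap : ℕ} {x : V → ℝ × ℝ}

/-- The circle of the range query for a vertex at position `y`. -/
def queryCircle (R : ℝ) (y : ℝ × ℝ) : Circle := circleToEuclidean R y.1 (mapToPoincare y.2)

open Classical in
/-- An upper bound for the cost of finding the neighbors of `v`. -/
def queryCost (α R : ℝ) (cap k : ℕ) (x : V → ℝ × ℝ) (v : V) : ℕ :=
  1 + ((cap + 1) + (4 * (cap + 1) + 1) *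
    treeSum (expanded α R cap x (queryCircle R (x v))) k 1 0 0) +
  (Finset.univ.filter (Hits (queryCircle R (x v)) x)).card

theorem edgeLoop_returns (hα : 0 < α) (hR : 0 < R) (hcap : 1 ≤ cap) {k : ℕ}
    (hsep : Separated α R x (2 ^ k)) (hx : ∀ v, (gridCell α R 1 0 0).Contains (x v))
    (hQ : ∀ v, (queryCircle R (x v)).Central) {T : QuadTree V}
    (hT : Stores α R cap x T 1 0 0 Finset.univ) : ∀ (vs : List V) (E : List (V × V)), ∃ E' t,
      (edgeLoop R T x vs E).Returns E' t ∧
      (∀ a b, (a, b) ∈ E' ↔ (a, b) ∈ E ∨ (a ∈ vs ∧ a ≠ b ∧ Hits (queryCircle R (x a)) x b)) ∧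
      t ≤ (vs.map (queryCost α R cap k x)).sum := by
  intro vs
  induction vs with
  | nil => exact fun E => ⟨E, 0, rfl, by simp, by simp⟩
  | cons v vs ih =>
    intro E
    obtain ⟨ws, t₁, a1, a2, a3, a4⟩ := query_returns hα hR hcap (hQ v) k T 1 0 0 Finset.univ []
      one_pos (by rwa [one_mul]) hT (fun v _ => hx v)
    obtain ⟨E₁, b1, b2⟩ := addEdges_returns v ws E
    obtain ⟨E₂, t₂, c1, c2, c3⟩ := ih E₁
    refine ⟨E₂, 1 + (t₁ + (ws.length + t₂)), ?_, fun a b => ?_, ?_⟩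
    · rw [edgeLoop]
      exact (returns_tick 1).bind (a1.bind (b1.bind c1))
    · rw [c2, b2, a2, List.mem_cons]
      have : a = v → ((b ∈ ([] : List V) ∨ b ∈ Finset.univ ∧ Hits (queryCircle R (x v)) x b) ↔
          Hits (queryCircle R (x a)) x b) := by
        rintro rfl
        simp
      constructor
      · rintro ((h | ⟨h1, h2, h3⟩) | ⟨h1, h2⟩)
        · exact Or.inl h
        · exact Or.inr ⟨Or.inl h1, fun h => h3 (h ▸ h1), (this h1).1 h2⟩
        · exact Or.inr ⟨Or.inr h1, h2⟩
      · rintro (h | ⟨h1 | h1, h2, h3⟩)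
        · exact Or.inl (Or.inl h)
        · exact Or.inl (Or.inr ⟨h1, (this h1).2 h3, fun h => h2 (h1.trans h.symm)⟩)
        · exact Or.inr ⟨h1, h2, h3⟩
    · rw [List.map_cons, List.sum_cons, queryCost]
      rw [List.length_nil, zero_add] at a3
      omega

end EdgeLoop

/-! The generator -/

/-- With `0 ≤ lo` this yields `R > 0`, the only property of the returned radius that is needed. -/
lemma lt_targetRadius (n : ℕ) (k α ε : ℝ) (rounds : ℕ) : ∀ lo hi : ℝ, lo < hi →
    lo < (targetRadius n k α ε rounds lo hi).1 := by
  induction rounds with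
  | zero =>
    intro lo hi h
    simp only [targetRadius]
    linarith
  | succ m ih =>
    intro lo hi h
    simp only [targetRadius]
    split_ifs
    · simp only
      linarith
    · exact ih _ _ (by linarith)
    · have := ih ((lo + hi) / 2) hi (by linarith)
      linarith

lemma targetRadius_cost_le (n : ℕ) (k α ε : ℝ) (rounds : ℕ) : ∀ lo hi : ℝ,
    (targetRadius n k α ε rounds lo hi).2 ≤ rounds + 1 := by
  induction rounds with
  | zero => exact fun _ _ => le_rfl
  | succ m ih =>
    intro lo hi
    simp only [targetRadius]
    split_ifs
    · simp
    · exact Nat.succ_le_succ (ih _ _)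
    · exact Nat.succ_le_succ (ih _ _)

lemma queryCircle_central {α R : ℝ} (hα : 0 < α) (hR : 0 < R) {y : ℝ × ℝ}
    (hy : (gridCell α R 1 0 0).Contains y) : (queryCircle R y).Central := by
  rw [gridCell_one hα hR] at hy
  exact circle_central hy.1.1 hy.1.2 hy.2.1 hy.2.2

/-- The deterministic half of the theorem. Result and cost do not depend on the depth bound once it
is large enough, so the unbounded recursion terminates too. -/
theorem generate_returns {cap n : ℕ} {k α lo hi ε : ℝ} {rounds : ℕ} {x : Fin n → ℝ × ℝ}
    (hcap : 1 ≤ cap) (hα : 0 < α) (hlo : 0 ≤ lo) (hlohi : lo < hi) (hrounds : rounds ≤ n)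
    {R : ℝ} (hRdef : R = (targetRadius n k α ε rounds lo hi).1) {m : ℕ}
    (hsep : Separated α R x (2 ^ m)) (hx : ∀ v, (gridCell α R 1 0 0).Contains (x v)) :
    ∃ E t, (∀ depth, 2 * m + 1 ≤ depth →
        (generate cap n k α lo hi ε rounds x depth).Returns E t) ∧
      (∀ v w, (v, w) ∈ E ↔ (hyperbolicGraph R x).Adj v w) ∧
      t ≤ n + 1 + n * ((m + 1) * (5 * (cap + 1) + 1) + 1) +
        ∑ v, queryCost α R cap m x v := by
  have hR : 0 < R := hRdef ▸ hlo.trans_lt (lt_targetRadius n k α ε rounds lo hi hlohi)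
  have hQ := fun v => queryCircle_central hα hR (hx v)
  obtain ⟨T, t₁, a1, a2, a3⟩ := insertLoop_stores hα hR hcap hsep hx (List.finRange n)
    (.leaf ⟨0, 2 * Real.pi, 0, R⟩ []) ∅
    ⟨(gridCell_one hα hR).symm, Nat.zero_le _, [], rfl, List.nodup_nil, rfl⟩
    (List.nodup_finRange n) (fun _ _ => Finset.notMem_empty _)
  have huniv : (List.finRange n).toFinset ∪ ∅ = Finset.univ := by
    ext v
    simp
  rw [huniv] at a2
  obtain ⟨E, t₂, b1, b2, b3⟩ := edgeLoop_returns hα hR hcap hsep hx hQ a2 (List.finRange n) []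
  have hs := targetRadius_cost_le n k α ε rounds lo hi
  refine ⟨E, (targetRadius n k α ε rounds lo hi).2 + (t₁ + t₂), fun depth hd => ?_,
    fun v w => ?_, ?_⟩
  · rw [generate]
    refine (returns_tick _).bind ?_
    rw [← hRdef]
    exact (a1 depth hd).bind b1
  · rw [b2]
    simp only [List.not_mem_nil, false_or, List.mem_finRange, true_and]
    exact and_congr_right fun _ => (hypDist_lt_iff hR (x v) (x w) (hQ v)).symm
  · rw [List.length_finRange] at a3
    rw [Fin.sum_univ_def]
    omega

/-! Counting expanded nodes -/

section Counting

variable {V : Type} {α R : ℝ} {cap : ℕ} {x : V → ℝ × ℝ}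

/-- Half-open cells of one grid are disjoint, so every vertex serves as witness for at most one
cell. -/
lemma card_cells_le (hα : 0 < α) (hR : 0 < R) {N : ℕ} {C : Finset (ℕ × ℕ)} {S : Finset V}
    (h : ∀ c ∈ C, ∃ v ∈ S, (gridCell α R N c.1 c.2).Contains (x v)) : C.card ≤ S.card := by
  refine Finset.card_le_card_of_forall_subsingleton
    (fun c v => (gridCell α R N c.1 c.2).Contains (x v)) h fun v _ c hc c' hc' => ?_
  obtain ⟨h1, h2⟩ := gridCell_index_eq hα hR hc.2 hc'.2
  exact Prod.ext h1 h2

lemma gridCell_index_lt (hα : 0 < α) (hR : 0 < R) {N i j : ℕ} (hN : 0 < N) {p : ℝ × ℝ}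
    (hp : (gridCell α R 1 0 0).Contains p) (h : (gridCell α R N i j).Contains p) :
    i < N ∧ j < N := by
  rw [← one_mul N] at h
  obtain ⟨h1, h2⟩ := gridCell_index_eq hα hR (h.ancestor hα hR hN) hp
  exact ⟨(Nat.div_eq_zero_iff_lt hN).1 h1, (Nat.div_eq_zero_iff_lt hN).1 h2⟩

open Classical in
/-- The cells of the `N × N` grid that the query circle around the position `y` straddles. -/
def straddlingCells (α R : ℝ) (N : ℕ) (y : ℝ × ℝ) : Finset (ℕ × ℕ) :=
  (Finset.range N ×ˢ Finset.range N).filter fun c =>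
    (gridCell α R 1 0 0).Contains y ∧ (gridCell α R N c.1 c.2).Straddles (queryCircle R y)

/-- The bound holds for every position: outside the root, where the circle need not enclose the
origin, the set is empty by definition. The probabilistic bound needs this uniformity. -/
lemma card_straddlingCells_le (hα : 0 < α) (hR : 0 < R) {N : ℕ} (hN : 0 < N) (y : ℝ × ℝ) :
    (straddlingCells α R N y).card ≤ 9 * N := by
  classical
  by_cases hy : (gridCell α R 1 0 0).Contains y
  · refine le_trans (Finset.card_le_card ?_)
      (card_straddling_cells_le hα hR (queryCircle_central hα hR hy) hN)
    intro c hc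
    obtain ⟨h1, -, h2⟩ := Finset.mem_filter.1 hc
    exact Finset.mem_filter.2 ⟨h1, h2⟩
  · rw [straddlingCells, Finset.filter_false_of_mem fun c _ h => hy h.1]
    simp

variable [Fintype V]

open Classical in
-- An expanded cell contains a vertex. If that vertex is hit, the cell is charged to it; if not, the
-- cell has a point outside the circle as well as one inside, so it is straddled.
lemma sum_expanded_le (hα : 0 < α) (hR : 0 < R) (hx : ∀ v, (gridCell α R 1 0 0).Contains (x v))
    (u : V) (N : ℕ) :
    ∑ i ∈ Finset.range N, ∑ j ∈ Finset.range N, expanded α R cap x (queryCircle R (x u)) N i j ≤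
      (Finset.univ.filter (Hits (queryCircle R (x u)) x)).card +
      ((straddlingCells α R N (x u)).filter fun c =>
        ∃ v, (gridCell α R N c.1 c.2).Contains (x v)).card := by
  set Q := queryCircle R (x u)
  rw [← Finset.sum_product']
  simp only [expanded]
  rw [← Finset.card_filter]
  set A := (Finset.range N ×ˢ Finset.range N).filter fun c : ℕ × ℕ =>
    ∃ v, Hits Q x v ∧ (gridCell α R N c.1 c.2).Contains (x v)
  have hAc : A.card ≤ (Finset.univ.filter (Hits Q x)).card :=
    card_cells_le hα hR fun c hc => by
      simpa using (Finset.mem_filter.1 hc).2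
  refine le_trans (le_trans (Finset.card_le_card (t := A ∪
    (straddlingCells α R N (x u)).filter fun c =>
      ∃ v, (gridCell α R N c.1 c.2).Contains (x v)) ?_) (Finset.card_union_le _ _))
    (Nat.add_le_add_right hAc _)
  intro c hc
  obtain ⟨h1, h2, h3⟩ := Finset.mem_filter.1 hc
  obtain ⟨v, hv⟩ := Finset.card_pos.1 (Nat.zero_lt_of_lt h2)
  have hv := (Finset.mem_filter.1 hv).2
  rw [Finset.mem_union]
  by_cases hit : Hits Q x v
  · exact Or.inl (Finset.mem_filter.2 ⟨h1, v, hit, hv⟩)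
  · exact Or.inr (Finset.mem_filter.2 ⟨Finset.mem_filter.2
      ⟨h1, hx u, h3, _, _, hv.covers hα hR, hit⟩, v, hv⟩)

open Classical in
/-- The vertices in the cells of the `N × N` grid that the query circle of `u` straddles. -/
def straddlingVertices (α R : ℝ) (N : ℕ) (x : V → ℝ × ℝ) (u : V) : Finset V :=
  Finset.univ.filter fun v => ∃ c ∈ straddlingCells α R N (x u),
    (gridCell α R N c.1 c.2).Contains (x v)

open Classical in
-- For `l ≤ m` all straddled cells are counted, at most `9 * 2 ^ l`. For `l ≥ m` each occupied one
-- is charged to a vertex, which lies in the straddled ancestor at level `m`.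
lemma card_occupied_straddlingCells_le (hα : 0 < α) (hR : 0 < R) (u : V) (l m : ℕ) :
    ((straddlingCells α R (2 ^ l) (x u)).filter fun c =>
        ∃ v, (gridCell α R (2 ^ l) c.1 c.2).Contains (x v)).card ≤
      9 * 2 ^ m + (straddlingVertices α R (2 ^ m) x u).card := by
  rcases le_total l m with h | h
  · refine (Finset.card_filter_le _ _).trans
      ((card_straddlingCells_le hα hR (by positivity) _).trans ?_)
    have : 2 ^ l ≤ 2 ^ m := Nat.pow_le_pow_right two_pos h
    omega
  · obtain ⟨e, rfl⟩ := Nat.exists_eq_add_of_le h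
    refine le_trans (card_cells_le (x := x) hα hR (N := 2 ^ (m + e)) fun c hc => ?_)
      (Nat.le_add_left _ _)
    obtain ⟨h1, v, hv⟩ := Finset.mem_filter.1 hc
    obtain ⟨h2, h3, h4⟩ := Finset.mem_filter.1 h1
    obtain ⟨h5, h6⟩ := Finset.mem_product.1 h2
    refine ⟨v, Finset.mem_filter.2 ⟨Finset.mem_univ v, (c.1 / 2 ^ e, c.2 / 2 ^ e), ?_, ?_⟩, hv⟩
    · rw [pow_add] at h4 h5 h6
      exact Finset.mem_filter.2 ⟨Finset.mem_product.2
        ⟨Finset.mem_range.2 (Nat.div_lt_of_lt_mul (mul_comm (2 ^ m) _ ▸ Finset.mem_range.1 h5)),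
          Finset.mem_range.2 (Nat.div_lt_of_lt_mul (mul_comm (2 ^ m) _ ▸ Finset.mem_range.1 h6))⟩,
        h3, h4.ancestor hα hR (by positivity)⟩
    · rw [pow_add] at hv
      exact hv.ancestor hα hR (by positivity)

open Classical in
lemma queryCost_le (hα : 0 < α) (hR : 0 < R)
    (hx : ∀ v, (gridCell α R 1 0 0).Contains (x v)) (k m : ℕ) (u : V) :
    queryCost α R cap k x u ≤ 1 + ((cap + 1) + (4 * (cap + 1) + 1) *
      (k * ((Finset.univ.filter (Hits (queryCircle R (x u)) x)).card +
        (9 * 2 ^ m + (straddlingVertices α R (2 ^ m) x u).card)))) +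
      (Finset.univ.filter (Hits (queryCircle R (x u)) x)).card := by
  have h := sum_treeSum (expanded α R cap x (queryCircle R (x u))) k 1
  rw [Finset.sum_range_one, Finset.sum_range_one] at h
  rw [queryCost, h]
  gcongr
  rw [← smul_eq_mul k]
  nth_rw 2 [← Finset.card_range k]
  refine Finset.sum_le_card_nsmul _ _ _ fun l _ => ?_
  rw [mul_one]
  exact (sum_expanded_le hα hR hx u (2 ^ l)).trans
    (Nat.add_le_add_left (card_occupied_straddlingCells_le hα hR u l m) _)

end Counting

/-! Probabilities -/

section Probability

variable {X : Type*} [MeasurableSpace X] {μ : Measure X} [IsProbabilityMeasure μ] {n : ℕ}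

lemma pi_forall_mem (S : Finset (Fin n)) (t : Fin n → Set X) :
    (Measure.pi fun _ : Fin n => μ) {x | ∀ w ∈ S, x w ∈ t w} = ∏ w ∈ S, μ (t w) := by
  classical
  have h : {x : Fin n → X | ∀ w ∈ S, x w ∈ t w} =
      Set.univ.pi fun w => if w ∈ S then t w else Set.univ := by
    ext x
    simp only [Set.mem_ofPred_eq, Set.mem_univ_pi]
    refine forall_congr' fun w => ?_
    split_ifs with hw <;> simp [hw]
  rw [h, Measure.pi_pi, ← Finset.prod_subset (Finset.subset_univ S)]
  · exact Finset.prod_congr rfl fun w hw => by rw [if_pos hw]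
  · intro w _ hw
    rw [if_neg hw, measure_univ]

/-- If the set `F y` of cells covers mass at most `b` for every position `y`, then it is unlikely
that for some `v` at least `K` other points lie in the cells `F (x v)`. -/
lemma measure_exists_many_le {ι : Type*} (U : Finset ι) (cell : ι → Set X) (F : X → Finset ι)
    (hFU : ∀ y, F y ⊆ U) (hF : ∀ s, MeasurableSet (F ⁻¹' {s})) (b : ENNReal)
    (hb : ∀ y, μ (⋃ c ∈ F y, cell c) ≤ b) (K : ℕ) :
    (Measure.pi fun _ : Fin n => μ) {x | ∃ v, ∃ S : Finset (Fin n), v ∉ S ∧ S.card = K ∧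
      ∀ w ∈ S, ∃ c ∈ F (x v), x w ∈ cell c} ≤ n * (n.choose K * b ^ K) := by
  classical
  set P := Measure.pi fun _ : Fin n => μ
  -- Fixing the value of `F (x v)` turns the event into a product event: as `v ∉ S`, the points of
  -- `S` are independent of `x v` and must fall into a fixed union of cells.
  have hone : ∀ (v : Fin n) (S : Finset (Fin n)), v ∉ S → S.card = K → ∀ s ∈ U.powerset,
      P {x | F (x v) = s ∧ ∀ w ∈ S, ∃ c ∈ F (x v), x w ∈ cell c} ≤ μ (F ⁻¹' {s}) * b ^ K := by
    intro v S hv hS s _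
    by_cases hs : ∃ y, F y = s
    · obtain ⟨y, rfl⟩ := hs
      calc _ ≤ P {x | ∀ w ∈ Insert.insert v S,
            x w ∈ if w = v then F ⁻¹' {F y} else ⋃ c ∈ F y, cell c} := by
            refine measure_mono ?_
            rintro x ⟨h1, h2⟩ w hw
            rcases Finset.mem_insert.1 hw with rfl | hw
            · rw [if_pos rfl]
              exact h1
            · rw [if_neg (ne_of_mem_of_not_mem hw hv)]
              obtain ⟨c, hc, hc'⟩ := h2 w hw
              exact Set.mem_biUnion (h1 ▸ hc) hc'
        _ = μ (F ⁻¹' {F y}) * ∏ w ∈ S, μ (⋃ c ∈ F y, cell c) := by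
            rw [pi_forall_mem, Finset.prod_insert hv, if_pos rfl]
            congr 1
            exact Finset.prod_congr rfl fun w hw => by rw [if_neg (ne_of_mem_of_not_mem hw hv)]
        _ ≤ μ (F ⁻¹' {F y}) * b ^ K := by
            rw [Finset.prod_const, hS]
            gcongr
            exact hb y
    · have : {x : Fin n → X | F (x v) = s ∧ ∀ w ∈ S, ∃ c ∈ F (x v), x w ∈ cell c} = ∅ :=
        Set.eq_empty_of_forall_notMem fun x hx => hs ⟨_, hx.1⟩
      rw [this, measure_empty]
      exact zero_le
  have htwo : ∀ (v : Fin n) (S : Finset (Fin n)), v ∉ S → S.card = K →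
      P {x | ∀ w ∈ S, ∃ c ∈ F (x v), x w ∈ cell c} ≤ b ^ K := by
    intro v S hv hS
    calc _ ≤ P (⋃ s ∈ U.powerset, {x | F (x v) = s ∧ ∀ w ∈ S, ∃ c ∈ F (x v), x w ∈ cell c}) :=
          measure_mono fun x hx =>
            Set.mem_biUnion (Finset.mem_coe.2 (Finset.mem_powerset.2 (hFU (x v)))) ⟨rfl, hx⟩
      _ ≤ ∑ s ∈ U.powerset, μ (F ⁻¹' {s}) * b ^ K :=
          (measure_biUnion_finset_le _ _).trans (Finset.sum_le_sum (hone v S hv hS))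
      _ ≤ 1 * b ^ K := by
          -- The finitely many values of `F` give disjoint events, so their probabilities sum to at
          -- most one.
          rw [← Finset.sum_mul, sum_measure_preimage_singleton _ fun s _ => hF s]
          gcongr
          exact prob_le_one
      _ = b ^ K := one_mul _
  calc _ ≤ P (⋃ v ∈ (Finset.univ : Finset (Fin n)), ⋃ S ∈ (Finset.univ.erase v).powersetCard K,
        {x | ∀ w ∈ S, ∃ c ∈ F (x v), x w ∈ cell c}) := by
        refine measure_mono ?_
        rintro x ⟨v, S, hv, hS, h⟩
        refine Set.mem_biUnion (Finset.mem_coe.2 (Finset.mem_univ v))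
          (Set.mem_biUnion (Finset.mem_coe.2 (Finset.mem_powersetCard.2 ⟨?_, hS⟩)) h)
        exact fun w hw => Finset.mem_erase.2 ⟨fun hwv => hv (hwv ▸ hw), Finset.mem_univ w⟩
    _ ≤ ∑ v : Fin n, ∑ S ∈ (Finset.univ.erase v).powersetCard K, b ^ K := by
        refine (measure_biUnion_finset_le _ _).trans (Finset.sum_le_sum fun v _ => ?_)
        refine (measure_biUnion_finset_le _ _).trans (Finset.sum_le_sum fun S hS => ?_)
        obtain ⟨h1, h2⟩ := Finset.mem_powersetCard.1 hS
        exact htwo v S (fun hv => (Finset.mem_erase.1 (h1 hv)).1 rfl) h2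
    _ ≤ ∑ v : Fin n, (n.choose K * b ^ K) := by
        refine Finset.sum_le_sum fun v _ => ?_
        rw [Finset.sum_const, Finset.card_powersetCard, nsmul_eq_mul]
        gcongr
        simp
    _ = n * (n.choose K * b ^ K) := by
        rw [Finset.sum_const, Finset.card_univ, Fintype.card_fin, nsmul_eq_mul]

lemma measure_exists_collision_le {ι : Type*} (U : Finset ι) (cell : ι → Set X) (δ : ENNReal)
    (hδ : ∀ c ∈ U, μ (cell c) ≤ δ) :
    (Measure.pi fun _ : Fin n => μ) {x | ∃ v w, v ≠ w ∧ ∃ c ∈ U, x v ∈ cell c ∧ x w ∈ cell c} ≤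
      n * (n * (U.card * δ ^ 2)) := by
  classical
  set P := Measure.pi fun _ : Fin n => μ
  calc _ ≤ P (⋃ v ∈ (Finset.univ : Finset (Fin n)), ⋃ w ∈ (Finset.univ : Finset (Fin n)),
        ⋃ c ∈ U, {x | v ≠ w ∧ x v ∈ cell c ∧ x w ∈ cell c}) := by
        refine measure_mono ?_
        rintro x ⟨v, w, hvw, c, hc, h⟩
        exact Set.mem_biUnion (Finset.mem_coe.2 (Finset.mem_univ v))
          (Set.mem_biUnion (Finset.mem_coe.2 (Finset.mem_univ w))
            (Set.mem_biUnion (Finset.mem_coe.2 hc) ⟨hvw, h⟩))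
    _ ≤ ∑ v : Fin n, ∑ w : Fin n, ∑ c ∈ U, δ ^ 2 := by
        refine (measure_biUnion_finset_le _ _).trans (Finset.sum_le_sum fun v _ => ?_)
        refine (measure_biUnion_finset_le _ _).trans (Finset.sum_le_sum fun w _ => ?_)
        refine (measure_biUnion_finset_le _ _).trans (Finset.sum_le_sum fun c hc => ?_)
        by_cases hvw : v = w
        · simp [hvw]
        · calc _ ≤ P {x | ∀ u ∈ ({v, w} : Finset (Fin n)), x u ∈ cell c} := by
                refine measure_mono ?_
                rintro x ⟨-, h1, h2⟩ u hu
                rcases Finset.mem_insert.1 hu with rfl | hu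
                · exact h1
                · rwa [Finset.mem_singleton.1 hu]
            _ ≤ δ ^ 2 := by
                rw [pi_forall_mem, Finset.prod_const, Finset.card_pair hvw]
                gcongr
                exact hδ c hc
    _ = _ := by
        simp only [Finset.sum_const, Finset.card_univ, Fintype.card_fin, nsmul_eq_mul]

end Probability

/-! The mass of grid cells -/

lemma angleLaw_Ico {a b : ℝ} (ha : 0 ≤ a) (hb : b ≤ 2 * Real.pi) :
    angleLaw (Set.Ico a b) = ENNReal.ofReal ((b - a) / (2 * Real.pi)) := by
  rw [angleLaw, withDensity_const, Measure.smul_apply, Measure.restrict_apply measurableSet_Ico,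
    Set.inter_eq_left.2 (Set.Ico_subset_Ico ha hb), Real.volume_Ico, smul_eq_mul,
    ← ENNReal.ofReal_mul (by positivity)]
  congr 1
  ring

lemma radialLaw_Ico {α R a b : ℝ} (hα : 0 < α) (hR : 0 < R) (ha : 0 ≤ a) (hab : a ≤ b)
    (hb : b ≤ R) : radialLaw α R (Set.Ico a b) = ENNReal.ofReal
      ((Real.cosh (α * b) - Real.cosh (α * a)) / (Real.cosh (α * R) - 1)) := by
  have hc := sub_pos.2 (one_lt_cosh_mul hα hR)
  have hcont : Continuous fun r => α * Real.sinh (α * r) / (Real.cosh (α * R) - 1) := by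
    fun_prop
  rw [radialLaw, withDensity_apply _ measurableSet_Ico,
    Measure.restrict_restrict measurableSet_Ico,
    Set.inter_eq_left.2 (Set.Ico_subset_Ico ha hb), ← ofReal_integral_eq_lintegral_ofReal,
    integral_Ico_eq_integral_Ioc, ← intervalIntegral.integral_of_le hab]
  · congr 1
    rw [intervalIntegral.integral_eq_sub_of_hasDerivAt
      (f := fun r => Real.cosh (α * r) / (Real.cosh (α * R) - 1)), sub_div]
    · intro r _
      refine HasDerivAt.div_const ?_ _
      have := ((hasDerivAt_id r).const_mul α).cosh
      simp only [id, mul_one] at this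
      rwa [mul_comm α (Real.sinh _)]
    · exact hcont.intervalIntegrable _ _
  · exact (hcont.integrableOn_Icc (a := a) (b := b)).mono_set Set.Ico_subset_Icc_self
  · refine (ae_restrict_mem measurableSet_Ico).mono fun r hr => ?_
    exact div_nonneg (mul_nonneg hα.le (Real.sinh_nonneg_iff.2
      (mul_nonneg hα.le (ha.trans hr.1)))) hc.le

lemma isProbabilityMeasure_position {α R : ℝ} (hα : 0 < α) (hR : 0 < R) :
    IsProbabilityMeasure (angleLaw.prod (radialLaw α R)) := by
  have h1 : IsProbabilityMeasure angleLaw := ⟨by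
    have h := angleLaw_Ico le_rfl (le_refl (2 * Real.pi))
    rw [sub_zero, div_self Real.two_pi_pos.ne', ENNReal.ofReal_one] at h
    rw [← h, angleLaw, withDensity_apply _ measurableSet_Ico, withDensity_apply _ .univ,
      Measure.restrict_restrict measurableSet_Ico, Measure.restrict_univ, Set.inter_self]⟩
  have h2 : IsProbabilityMeasure (radialLaw α R) := ⟨by
    have h := radialLaw_Ico hα hR le_rfl hR.le le_rfl
    rw [mul_zero, Real.cosh_zero, div_self (sub_pos.2 (one_lt_cosh_mul hα hR)).ne',
      ENNReal.ofReal_one] at h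
    rw [← h, radialLaw, withDensity_apply _ measurableSet_Ico, withDensity_apply _ .univ,
      Measure.restrict_restrict measurableSet_Ico, Measure.restrict_univ, Set.inter_self]⟩
  infer_instance

lemma setOf_contains (c : Cell) :
    {p | c.Contains p} = Set.Ico c.minφ c.maxφ ×ˢ Set.Ico c.minH c.maxH := rfl

lemma measurableSet_contains (c : Cell) : MeasurableSet {p | c.Contains p} :=
  measurableSet_Ico.prod measurableSet_Ico

lemma measure_gridCell {α R : ℝ} (hα : 0 < α) (hR : 0 < R) {N i j : ℕ} (hi : i < N)
    (hj : j < N) : (angleLaw.prod (radialLaw α R)) {p | (gridCell α R N i j).Contains p} =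
      ENNReal.ofReal (1 / (N : ℝ) ^ 2) := by
  have := isProbabilityMeasure_position hα hR
  have hN : (0 : ℝ) < N := by exact_mod_cast (Nat.zero_le i).trans_lt hi
  have hle : ((j : ℝ) + 1) / N ≤ 1 := by
    rw [div_le_one hN]
    exact_mod_cast hj
  have hj0 : (0 : ℝ) ≤ j / N := by positivity
  have hj1 : (0 : ℝ) ≤ ((j : ℝ) + 1) / N := by positivity
  have hjj : (j : ℝ) / N ≤ ((j : ℝ) + 1) / N := by
    gcongr
    linarith
  have hm := (radialQuantile_strictMonoOn hα hR).monotoneOn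
  have hc := sub_pos.2 (one_lt_cosh_mul hα hR)
  have hlast : (gridCell α R N i j).maxH ≤ R := by
    have := hm hj1 (Set.mem_Ici.2 zero_le_one) hle
    rwa [radialQuantile_one hα hR] at this
  have hsf : SFinite (radialLaw α R) := by
    unfold radialLaw
    infer_instance
  rw [setOf_contains, Measure.prod_prod, angleLaw_Ico (gridCell_minφ_nonneg _ _ _)
    (gridCell_maxφ_le hi j), radialLaw_Ico (a := (gridCell α R N i j).minH)
    (b := (gridCell α R N i j).maxH) hα hR (radialQuantile_nonneg hα hR hj0)
    (hm hj0 hj1 hjj) hlast]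
  simp only [gridCell]
  rw [cosh_radialQuantile hα hR hj0, cosh_radialQuantile hα hR hj1,
    ← ENNReal.ofReal_mul]
  · congr 1
    have hp := Real.pi_pos
    field_simp
    ring
  · have : (2 * Real.pi * (((i : ℝ) + 1) / N) - 2 * Real.pi * (i / N)) / (2 * Real.pi) = 1 / N := by
      have hp := Real.pi_pos
      field_simp
      ring
    rw [this]
    positivity

/-! Measurability of the straddled cells -/

lemma continuous_polarDist_queryCircle (R φ r : ℝ) :
    Continuous fun y : ℝ × ℝ => polarDist φ r (queryCircle R y).φ (queryCircle R y).r := by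
  obtain ⟨h1, -⟩ := continuous_circle R
  unfold polarDist
  change Continuous fun y : ℝ × ℝ => √(r ^ 2 + (circleToEuclidean R y.1 (mapToPoincare y.2)).r ^ 2 -
    2 * r * (circleToEuclidean R y.1 (mapToPoincare y.2)).r * Real.cos (φ - y.1))
  fun_prop

lemma isOpen_meets (R : ℝ) (c : Cell) : IsOpen {y | c.Meets (queryCircle R y)} := by
  have : {y | c.Meets (queryCircle R y)} = ⋃ (φ) (r) (_ : c.Covers φ r),
      {y | polarDist φ r (queryCircle R y).φ (queryCircle R y).r < (queryCircle R y).rad} := by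
    ext y
    simp [Cell.Meets, Circle.Inside]
  rw [this]
  exact isOpen_iUnion fun φ => isOpen_iUnion fun r => isOpen_iUnion fun _ =>
    isOpen_lt (continuous_polarDist_queryCircle R φ r) (continuous_circle R).2

/-- The outside condition is closed jointly in cell point and position, and projecting along the
compact cell preserves closedness. -/
lemma isClosed_exits (R : ℝ) (c : Cell) : IsClosed {y | c.Exits (queryCircle R y)} := by
  set K : Set (ℝ × ℝ) := Set.Icc c.minφ c.maxφ ×ˢ Set.Icc c.minE c.maxE
  have : CompactSpace K := isCompact_iff_compactSpace.1 (isCompact_Icc.prod isCompact_Icc)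
  have hcl : IsClosed {z : K × (ℝ × ℝ) | (queryCircle R z.2).rad ≤
      polarDist z.1.1.1 z.1.1.2 (queryCircle R z.2).φ (queryCircle R z.2).r} := by
    obtain ⟨h1, h2⟩ := continuous_circle R
    refine isClosed_le (h2.comp continuous_snd) ?_
    unfold polarDist
    have h3 : Continuous fun z : K × (ℝ × ℝ) => (queryCircle R z.2).r := h1.comp continuous_snd
    have h4 : Continuous fun z : K × (ℝ × ℝ) => (queryCircle R z.2).φ :=
      continuous_fst.comp continuous_snd
    fun_prop
  convert isClosedMap_snd_of_compactSpace _ hcl using 1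
  ext y
  simp only [Set.mem_ofPred_eq, Set.mem_image, Prod.exists, exists_eq_right, Subtype.exists,
    Cell.Exits, Circle.Inside, not_lt]
  exact ⟨fun ⟨φ, r, h1, h2⟩ => ⟨φ, r, h1, h2⟩, fun ⟨φ, r, h1, h2⟩ => ⟨φ, r, h1, h2⟩⟩

lemma measurableSet_straddlingCells (α R : ℝ) (N : ℕ) (s : Finset (ℕ × ℕ)) :
    MeasurableSet (straddlingCells α R N ⁻¹' {s}) := by
  have h : straddlingCells α R N ⁻¹' {s} =
      ⋂ c, {y | c ∈ straddlingCells α R N y ↔ c ∈ s} := by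
    ext y
    simp [Finset.ext_iff]
  have hc : ∀ c, MeasurableSet {y | c ∈ straddlingCells α R N y} := by
    intro c
    simp only [straddlingCells, Finset.mem_filter]
    exact (MeasurableSet.const _).inter ((measurableSet_contains _).inter
      ((isOpen_meets R _).measurableSet.inter (isClosed_exits R _).measurableSet))
  rw [h]
  refine MeasurableSet.iInter fun c => ?_
  by_cases hs : c ∈ s
  · simpa [hs] using hc c
  · have : {y | c ∈ straddlingCells α R N y ↔ c ∈ s} = {y | c ∈ straddlingCells α R N y}ᶜ := by
      ext y
      simp [hs]
    exact this ▸ (hc c).compl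

/-! ### Tail estimates and the good event -/

lemma straddling_bound {n N : ℕ} (hn : 1 ≤ n) (hN : 1 ≤ N) (hnN : n ≤ 4 * N ^ 2) :
    (n : ℝ) * (n.choose (216 * N) * (9 / (N : ℝ)) ^ (216 * N)) ≤ 1 / (2 * n) := by
  have hn' : (0 : ℝ) < n := by exact_mod_cast hn
  have hN' : (0 : ℝ) < N := by exact_mod_cast hN
  have hnN' : (n : ℝ) ≤ 4 * N ^ 2 := by exact_mod_cast hnN
  have hpow : 2 * n ^ 2 ≤ 2 ^ (216 * N) := by
    have h1 : N ≤ 2 ^ N := Nat.lt_two_pow_self.le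
    calc 2 * n ^ 2 ≤ 2 * (4 * (2 ^ N) ^ 2) ^ 2 := by
          have := hnN.trans (Nat.mul_le_mul_left 4 (Nat.pow_le_pow_left h1 2))
          gcongr
      _ = 2 ^ (5 + 4 * N) := by
          rw [mul_pow, ← pow_mul, ← pow_mul, pow_add, show N * (2 * 2) = 4 * N by ring]
          ring
      _ ≤ 2 ^ (216 * N) := Nat.pow_le_pow_right two_pos (by omega)
  have hpow' : (2 : ℝ) * n ^ 2 ≤ 2 ^ (216 * N) := by exact_mod_cast hpow
  -- Since `n * 9 / N ≤ 36 * N = K / 6` and `K! ≥ (K / e) ^ K`, the product is at most `(e / 6) ^ K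
  -- ≤ 2 ^ (-K)`, and `2 ^ K ≥ 2 * n ^ 2`.
  set K := 216 * N with hK
  have hK' : (K : ℝ) = 216 * N := by rw [hK]; push_cast; ring
  have hKpos : (0 : ℝ) < K := by rw [hK']; positivity
  have hfac : (0 : ℝ) < K.factorial := by exact_mod_cast K.factorial_pos
  have h2 : (K : ℝ) ^ K ≤ Real.exp 1 ^ K * K.factorial := by
    have := Real.pow_div_factorial_le_exp (K : ℝ) hKpos.le K
    rwa [div_le_iff₀ hfac, ← Real.exp_one_pow] at this
  have h3 : (n.choose K : ℝ) * (9 / (N : ℝ)) ^ K ≤ (1 / 2) ^ K := by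
    calc (n.choose K : ℝ) * (9 / (N : ℝ)) ^ K ≤ (n : ℝ) ^ K / K.factorial * (9 / (N : ℝ)) ^ K := by
          gcongr
          exact Nat.choose_le_pow_div K n
      _ = (n * (9 / (N : ℝ))) ^ K / K.factorial := by rw [mul_pow]; ring
      _ ≤ (36 * N) ^ K / K.factorial := by
          have : n * (9 / (N : ℝ)) ≤ 36 * N := by
            rw [← mul_div_assoc, div_le_iff₀ hN']
            nlinarith
          gcongr
      _ = (1 / 6) ^ K * (K : ℝ) ^ K / K.factorial := by
          rw [← mul_pow, hK']
          ring
      _ ≤ (1 / 6) ^ K * (Real.exp 1 ^ K * K.factorial) / K.factorial := by gcongr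
      _ = (1 / 6 * Real.exp 1) ^ K := by
          rw [mul_pow]
          field_simp
      _ ≤ (1 / 2) ^ K := by
          have := Real.exp_one_lt_d9
          gcongr
          linarith
  calc (n : ℝ) * (n.choose K * (9 / (N : ℝ)) ^ K) ≤ n * (1 / 2) ^ K := by gcongr
    _ = n / 2 ^ K := by rw [one_div, inv_pow, div_eq_mul_inv]
    _ ≤ n / (2 * n ^ 2) := by gcongr
    _ = 1 / (2 * n) := by field_simp

lemma collision_bound {n M : ℕ} (hn : 2 ≤ n) (hM : n ^ 4 ≤ M ^ 2) :
    (n : ℝ) * (n * ((M * M : ℕ) * (1 / (M : ℝ) ^ 2) ^ 2)) ≤ 1 / (2 * (n : ℝ)) := by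
  have hn' : (2 : ℝ) ≤ n := by exact_mod_cast hn
  have hM' : (n : ℝ) ^ 4 ≤ (M : ℝ) ^ 2 := by exact_mod_cast hM
  have hMpos : (0 : ℝ) < (M : ℝ) ^ 2 := lt_of_lt_of_le (by positivity) hM'
  calc (n : ℝ) * (n * ((M * M : ℕ) * (1 / (M : ℝ) ^ 2) ^ 2)) =
          (n : ℝ) ^ 2 / (M : ℝ) ^ 2 := by
        push_cast
        have : (M : ℝ) ≠ 0 := fun h => by simp [h] at hMpos
        field_simp
    _ ≤ (n : ℝ) ^ 2 / (n : ℝ) ^ 4 := by gcongr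
    _ = 1 / ((n : ℝ) * n) := by field_simp
    _ ≤ 1 / (2 * (n : ℝ)) := by gcongr

/-- The good event: no point leaves the disk, the grid of side length `M` separates the points and
no query circle straddles cells of the grid of side length `N` with many points. -/
def GoodPositions (α R : ℝ) (N M : ℕ) {n : ℕ} (x : Fin n → ℝ × ℝ) : Prop :=
  (∀ v, (gridCell α R 1 0 0).Contains (x v)) ∧ Separated α R x M ∧
    ∀ v, (straddlingVertices α R N x v).card ≤ 216 * N

lemma measure_not_good_le {α R : ℝ} (hα : 0 < α) (hR : 0 < R) {n N M : ℕ} (hn : 2 ≤ n)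
    (hN : 1 ≤ N) (hnN : n ≤ 4 * N ^ 2) (hM : n ^ 4 ≤ M ^ 2) :
    vertexLaw n α R {x | ¬ GoodPositions α R N M x} ≤ ENNReal.ofReal (1 / n) := by
  classical
  have hprob := isProbabilityMeasure_position hα hR
  set μ := angleLaw.prod (radialLaw α R) with hμ
  have hN' : (0 : ℝ) < N := by exact_mod_cast hN
  have hMpos : 0 < M := Nat.pos_of_ne_zero fun h => by
    have : 0 < n ^ 4 := by positivity
    rw [h] at hM
    omega
  set B₁ : Set (Fin n → ℝ × ℝ) := ⋃ v, {x | ¬ (gridCell α R 1 0 0).Contains (x v)}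
  set B₂ : Set (Fin n → ℝ × ℝ) := {x | ∃ v w, v ≠ w ∧ ∃ c ∈ Finset.range M ×ˢ Finset.range M,
    x v ∈ {p | (gridCell α R M c.1 c.2).Contains p} ∧
      x w ∈ {p | (gridCell α R M c.1 c.2).Contains p}}
  set B₃ : Set (Fin n → ℝ × ℝ) := {x | ∃ v, ∃ S : Finset (Fin n), v ∉ S ∧ S.card = 216 * N ∧
    ∀ w ∈ S, ∃ c ∈ straddlingCells α R N (x v), x w ∈ {p | (gridCell α R N c.1 c.2).Contains p}}
  have h1 : vertexLaw n α R B₁ = 0 := by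
    refine measure_iUnion_null fun v => ?_
    have h := pi_forall_mem (μ := μ) {v} fun _ => {p | (gridCell α R 1 0 0).Contains p}ᶜ
    rw [Finset.prod_singleton, prob_compl_eq_one_sub (measurableSet_contains _), hμ,
      measure_gridCell hα hR one_pos one_pos, Nat.cast_one, one_pow, div_one, ENNReal.ofReal_one,
      tsub_self] at h
    rw [← h]
    refine congrArg _ (Set.ext fun x => ?_)
    simp
  have h2 : vertexLaw n α R B₂ ≤ ENNReal.ofReal (1 / (2 * n)) := by
    refine (measure_exists_collision_le (μ := μ) (Finset.range M ×ˢ Finset.range M)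
      (fun c => {p | (gridCell α R M c.1 c.2).Contains p}) (ENNReal.ofReal (1 / (M : ℝ) ^ 2))
      fun c hc => ?_).trans ?_
    · obtain ⟨h5, h6⟩ := Finset.mem_product.1 hc
      exact (measure_gridCell hα hR (Finset.mem_range.1 h5) (Finset.mem_range.1 h6)).le
    · rw [Finset.card_product, Finset.card_range, ← ENNReal.ofReal_natCast n,
        ← ENNReal.ofReal_natCast, ← ENNReal.ofReal_pow (by positivity),
        ← ENNReal.ofReal_mul (by positivity), ← ENNReal.ofReal_mul (by positivity),
        ← ENNReal.ofReal_mul (by positivity)]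
      exact ENNReal.ofReal_le_ofReal (collision_bound hn hM)
  have h3 : vertexLaw n α R B₃ ≤ ENNReal.ofReal (1 / (2 * n)) := by
    refine (measure_exists_many_le (μ := μ) (Finset.range N ×ˢ Finset.range N)
      (fun c => {p | (gridCell α R N c.1 c.2).Contains p}) (straddlingCells α R N)
      (fun y => Finset.filter_subset _ _) (measurableSet_straddlingCells α R N)
      (ENNReal.ofReal (9 / N)) (fun y => ?_) (216 * N)).trans ?_
    · calc _ ≤ ∑ c ∈ straddlingCells α R N y, ENNReal.ofReal (1 / (N : ℝ) ^ 2) := by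
            refine (measure_biUnion_finset_le _ _).trans (Finset.sum_le_sum fun c hc => ?_)
            obtain ⟨h5, h6⟩ := Finset.mem_product.1 (Finset.mem_filter.1 hc).1
            exact (measure_gridCell hα hR (Finset.mem_range.1 h5) (Finset.mem_range.1 h6)).le
        _ ≤ ((9 * N : ℕ) : ENNReal) * ENNReal.ofReal (1 / (N : ℝ) ^ 2) := by
            rw [Finset.sum_const, nsmul_eq_mul]
            gcongr
            exact card_straddlingCells_le hα hR hN y
        _ = ENNReal.ofReal (9 / N) := by
            rw [← ENNReal.ofReal_natCast, ← ENNReal.ofReal_mul (by positivity)]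
            congr 1
            push_cast
            field_simp
    · rw [← ENNReal.ofReal_natCast n, ← ENNReal.ofReal_natCast,
        ← ENNReal.ofReal_pow (by positivity), ← ENNReal.ofReal_mul (by positivity),
        ← ENNReal.ofReal_mul (by positivity)]
      exact ENNReal.ofReal_le_ofReal (straddling_bound (by omega) hN hnN)
  calc _ ≤ vertexLaw n α R (B₁ ∪ (B₂ ∪ B₃)) := by
        refine measure_mono fun x hx => ?_
        by_contra hcon
        simp only [Set.mem_union, not_or] at hcon
        obtain ⟨c1, c2, c3⟩ := hcon
        have hroot : ∀ v, (gridCell α R 1 0 0).Contains (x v) := fun v => by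
          by_contra hv
          exact c1 (Set.mem_iUnion.2 ⟨v, hv⟩)
        refine hx ⟨hroot, fun v w i j hv hw => ?_, fun v => ?_⟩
        · by_contra hvw
          obtain ⟨hi, hj⟩ := gridCell_index_lt hα hR hMpos (hroot v) hv
          exact c2 ⟨v, w, hvw, (i, j), Finset.mem_product.2
            ⟨Finset.mem_range.2 hi, Finset.mem_range.2 hj⟩, hv, hw⟩
        · by_contra! hv
          -- A vertex may lie in a cell straddled by its own circle; it is removed so that the
          -- others are independent of it.
          have hcard : 216 * N ≤ ((straddlingVertices α R N x v).erase v).card := by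
            have := Finset.pred_card_le_card_erase (s := straddlingVertices α R N x v) (a := v)
            omega
          obtain ⟨S, hS, hSc⟩ := Finset.exists_subset_card_eq hcard
          refine c3 ⟨v, S, fun h => (Finset.mem_erase.1 (hS h)).1 rfl, hSc, fun w hw => ?_⟩
          exact (Finset.mem_filter.1 (Finset.mem_erase.1 (hS hw)).2).2
    _ ≤ 0 + (ENNReal.ofReal (1 / (2 * n)) + ENNReal.ofReal (1 / (2 * n))) :=
        (measure_union_le _ _).trans (add_le_add h1.le
          ((measure_union_le _ _).trans (add_le_add h2 h3)))
    _ = ENNReal.ofReal (1 / n) := by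
        rw [zero_add, ← ENNReal.ofReal_add (by positivity) (by positivity)]
        congr 1
        have : (n : ℝ) ≠ 0 := by positivity
        field_simp
        norm_num

/-! ### Total cost of all queries -/

open Classical in
-- Every circle may hit its own vertex besides the neighbors; the degrees sum to twice the number of
-- edges.
lemma sum_hits_le {α R : ℝ} (hα : 0 < α) (hR : 0 < R) {n : ℕ} {x : Fin n → ℝ × ℝ}
    (hx : ∀ v, (gridCell α R 1 0 0).Contains (x v)) :
    ∑ v, (Finset.univ.filter (Hits (queryCircle R (x v)) x)).card ≤
      n + 2 * (hyperbolicGraph R x).edgeSet.ncard := by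
  set G := hyperbolicGraph R x with hG
  have h : ∀ v, (Finset.univ.filter (Hits (queryCircle R (x v)) x)).card ≤ 1 + G.degree v := by
    intro v
    rw [add_comm, ← SimpleGraph.card_neighborFinset_eq_degree]
    refine (Finset.card_le_card fun w hw => ?_).trans (Finset.card_insert_le v _)
    rw [Finset.mem_insert, SimpleGraph.mem_neighborFinset]
    by_cases hvw : w = v
    · exact Or.inl hvw
    · exact Or.inr ⟨fun h => hvw h.symm, (hypDist_lt_iff hR (x v) (x w)
        (queryCircle_central hα hR (hx v))).2 (Finset.mem_filter.1 hw).2⟩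
  calc _ ≤ ∑ v, (1 + G.degree v) := Finset.sum_le_sum fun v _ => h v
    _ = n + 2 * G.edgeSet.ncard := by
      rw [Finset.sum_add_distrib, G.sum_degrees_eq_twice_card_edges,
        ← SimpleGraph.coe_edgeFinset, Set.ncard_coe_finset]
      simp

theorem steps_le {cap : ℕ} {α R : ℝ} (hα : 0 < α) (hR : 0 < R) {n L₀ k : ℕ} (hn : 1 ≤ n)
    {x : Fin n → ℝ × ℝ} (hx : GoodPositions α R (2 ^ L₀) (2 ^ k) x) :
    n + 1 + n * ((k + 1) * (5 * (cap + 1) + 1) + 1) + ∑ v, queryCost α R cap k x v ≤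
      1142 * (cap + 1) * (k + 1) * (2 ^ L₀ * n + (hyperbolicGraph R x).edgeSet.ncard) := by
  classical
  obtain ⟨hroot, -, hstr⟩ := hx
  set m := (hyperbolicGraph R x).edgeSet.ncard
  set N := 2 ^ L₀ with hNdef
  have hN : 1 ≤ N := Nat.one_le_two_pow
  have hsum := sum_hits_le hα hR hroot
  set h : Fin n → ℕ := fun v => (Finset.univ.filter (Hits (queryCircle R (x v)) x)).card
  have hq : ∑ v, queryCost α R cap k x v ≤
      n * (cap + 2) + (4 * (cap + 1) + 1) * (k * (n + 2 * m + n * (225 * N))) + (n + 2 * m) := by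
    calc _ ≤ ∑ v, ((cap + 2) + (4 * (cap + 1) + 1) * (k * (h v + 225 * N)) + h v) := by
          refine Finset.sum_le_sum fun v _ => (queryCost_le hα hR hroot k L₀ v).trans ?_
          -- `225 = 9 + 216`: straddled cells of the coarse levels plus vertices in straddled cells
          -- of level `L₀`.
          have h1 : 9 * 2 ^ L₀ + (straddlingVertices α R (2 ^ L₀) x v).card ≤ 225 * N := by
            have : (straddlingVertices α R (2 ^ L₀) x v).card ≤ 216 * N := hstr v
            omega
          have h2 : (4 * (cap + 1) + 1) * (k * (h v +
              (9 * 2 ^ L₀ + (straddlingVertices α R (2 ^ L₀) x v).card))) ≤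
              (4 * (cap + 1) + 1) * (k * (h v + 225 * N)) := by gcongr
          simp only [h] at *
          omega
      _ = n * (cap + 2) + (4 * (cap + 1) + 1) * (k * (∑ v, h v + n * (225 * N))) + ∑ v, h v := by
          rw [Finset.sum_add_distrib, Finset.sum_add_distrib, ← Finset.mul_sum, ← Finset.mul_sum,
            Finset.sum_add_distrib (f := h)]
          simp only [Finset.sum_const, Finset.card_univ, Fintype.card_fin, smul_eq_mul]
      _ ≤ _ := by gcongr
  -- All lower-order terms are absorbed into `D`; the constant is `1142 = 5 * 225 + 17`.
  set D := (cap + 1) * (k + 1) with hD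
  have hD1 : 1 ≤ D := Nat.one_le_iff_ne_zero.2 (by positivity)
  have hDc : cap + 1 ≤ D := Nat.le_mul_of_pos_right _ (Nat.succ_pos k)
  have hnN : n ≤ N * n := Nat.le_mul_of_pos_left n hN
  have e1 : (k + 1) * (5 * (cap + 1) + 1) ≤ 6 * D := by rw [hD]; nlinarith
  have e2 : (4 * (cap + 1) + 1) * k ≤ 5 * D := by rw [hD]; nlinarith
  have e3 : cap + 2 ≤ 2 * D := by omega
  calc _ ≤ n + 1 + n * (6 * D + 1) +
        (n * (2 * D) + 5 * D * (n + 2 * m + n * (225 * N)) + (n + 2 * m)) := by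
        refine add_le_add (by gcongr) (hq.trans ?_)
        rw [← mul_assoc (4 * (cap + 1) + 1) k]
        gcongr
    _ ≤ D * (n + n) + D * n * 7 + (D * n * 2 + 5 * D * (n + 2 * m + n * (225 * N)) +
        D * (n + 2 * m)) := by
        have a1 := Nat.mul_le_mul_right (n + n) hD1
        have a2 := Nat.mul_le_mul_right n hD1
        have a3 := Nat.mul_le_mul_right (n + 2 * m) hD1
        have a4 : n * (6 * D + 1) = D * n * 6 + n := by ring
        have a5 : n * (2 * D) = D * n * 2 := by ring
        omega
    _ = D * (17 * n + 1125 * (N * n) + 12 * m) := by ring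
    _ ≤ D * (1142 * (N * n + m)) := Nat.mul_le_mul_left D (by omega)
    _ = _ := by rw [hD]; ring

end RHG

end
-- The main theorem: choice of the two grids
theorem theorem1 (cap : ℕ) (hcap : 1 ≤ cap) :
    ∃ (C : ℝ) (n₀ : ℕ), ∀ n : ℕ, n₀ ≤ n →
      ∀ (k α lo hi ε : ℝ) (rounds : ℕ), 0 < α → 0 ≤ lo → lo < hi → rounds ≤ n →
      ∀ R : ℝ, R = (RHG.targetRadius n k α ε rounds lo hi).1 →
      ∃ A : Set (Fin n → ℝ × ℝ), MeasurableSet A ∧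
        ENNReal.ofReal (1 - 1 / (n : ℝ)) ≤ RHG.vertexLaw n α R A ∧
        ∀ x ∈ A, ∃ (E : List (Fin n × Fin n)) (t d : ℕ),
          (∀ depth : ℕ, d ≤ depth →
            (RHG.generate cap n k α lo hi ε rounds x depth).Returns E t) ∧
          (∀ v w : Fin n, (v, w) ∈ E ↔ (RHG.hyperbolicGraph R x).Adj v w) ∧
          (t : ℝ) ≤ C * (((n : ℝ) ^ (3 / 2 : ℝ) +
            ((RHG.hyperbolicGraph R x).edgeSet.ncard : ℝ)) * Real.log n) := by
  refine ⟨1142 * (cap + 1) * 12, 2, fun n hn k α lo hi ε rounds hα hlo hlohi hrounds R hR => ?_⟩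
  have hRpos : 0 < R := hR ▸ hlo.trans_lt (RHG.lt_targetRadius n k α ε rounds lo hi hlohi)
  -- The coarse side `N = 2 ^ L₀` satisfies `N² ≤ n < 4 N²`. The separating grid has side `2 ^ (4 *
  -- (L₀ + 1)) = (4 ^ (L₀ + 1))² ≥ n²`.
  set L₀ := Nat.log 4 n with hL₀
  have hle : 4 ^ L₀ ≤ n := Nat.pow_log_le_self 4 (by omega)
  have hlt : n < 4 ^ (L₀ + 1) := Nat.lt_pow_succ_log_self (by norm_num) n
  have hsq : ∀ a : ℕ, (2 ^ a) ^ 2 = 4 ^ a := fun a => by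
    rw [← pow_mul, mul_comm, pow_mul]
    norm_num
  have hprob := RHG.isProbabilityMeasure_position hα hRpos
  have hprob' : IsProbabilityMeasure (RHG.vertexLaw n α R) := by
    unfold RHG.vertexLaw
    infer_instance
  set Bad : Set (Fin n → ℝ × ℝ) :=
    {x | ¬ RHG.GoodPositions α R (2 ^ L₀) (2 ^ (4 * (L₀ + 1))) x} with hBad
  have hbad : RHG.vertexLaw n α R Bad ≤ ENNReal.ofReal (1 / n) := by
    refine RHG.measure_not_good_le hα hRpos hn Nat.one_le_two_pow ?_ ?_
    · rw [hsq]
      rw [pow_succ'] at hlt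
      exact hlt.le
    · rw [hsq, mul_comm 4, pow_mul]
      exact Nat.pow_le_pow_left hlt.le 4
  -- Measurability of the bad event is avoided by removing a measurable superset of the same
  -- measure.
  refine ⟨(toMeasurable (RHG.vertexLaw n α R) Bad)ᶜ, (measurableSet_toMeasurable _ _).compl, ?_,
    fun x hx => ?_⟩
  · rw [prob_compl_eq_one_sub (measurableSet_toMeasurable _ _), measure_toMeasurable,
      ENNReal.ofReal_sub _ (by positivity), ENNReal.ofReal_one]
    exact tsub_le_tsub_left hbad 1
  have hgood : RHG.GoodPositions α R (2 ^ L₀) (2 ^ (4 * (L₀ + 1))) x := by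
    by_contra hcon
    exact hx (subset_toMeasurable _ _ hcon)
  obtain ⟨E, t, h1, h2, h3⟩ := RHG.generate_returns (k := k) (ε := ε) hcap hα hlo hlohi hrounds hR
    hgood.2.1 hgood.1
  refine ⟨E, t, 2 * (4 * (L₀ + 1)) + 1, h1, h2, ?_⟩
  have h4 : t ≤ _ := h3.trans (RHG.steps_le hα hRpos (by omega) hgood)
  set m := (RHG.hyperbolicGraph R x).edgeSet.ncard
  have h5 : (t : ℝ) ≤ 1142 * (cap + 1) * ((4 * (L₀ + 1) : ℕ) + 1) * (2 ^ L₀ * n + m) := by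
    exact_mod_cast h4
  have hn' : (2 : ℝ) ≤ n := by exact_mod_cast hn
  have hlog2 : 0.69 < Real.log n :=
    (by linarith [Real.log_two_gt_d9] : 0.69 < Real.log 2).trans_le (Real.log_le_log two_pos hn')
  have hlogL : (L₀ : ℝ) ≤ Real.log n := by
    have e1 : (4 : ℝ) ^ L₀ ≤ n := by exact_mod_cast hle
    have e2 := Real.log_le_log (by positivity) e1
    rw [Real.log_pow] at e2
    have e3 : (1 : ℝ) ≤ Real.log 4 := by
      rw [show (4 : ℝ) = 2 ^ 2 by norm_num, Real.log_pow]
      have := Real.log_two_gt_d9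
      push_cast
      linarith
    nlinarith [(Nat.cast_nonneg L₀ : (0 : ℝ) ≤ L₀)]
  have hpow : (2 : ℝ) ^ L₀ * n ≤ (n : ℝ) ^ (3 / 2 : ℝ) := by
    have e1 : ((2 : ℝ) ^ L₀) ^ 2 ≤ n := by
      rw [← pow_mul, mul_comm, pow_mul]
      exact_mod_cast hle
    have e2 := Real.le_sqrt_of_sq_le e1
    rw [show (3 / 2 : ℝ) = 1 / 2 + 1 by norm_num, Real.rpow_add_one (by linarith),
      ← Real.sqrt_eq_rpow]
    gcongr
  calc (t : ℝ) ≤ 1142 * (cap + 1) * ((4 * (L₀ + 1) : ℕ) + 1) * (2 ^ L₀ * n + m) := h5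
    _ ≤ 1142 * (cap + 1) * (12 * Real.log n) * ((n : ℝ) ^ (3 / 2 : ℝ) + m) := by
        -- The level factor is `4 * L₀ + 5`, where `L₀ ≤ log n` and `5 ≤ 8 * 0.69 ≤ 8 * log n`; this
        -- gives the `12`.
        gcongr
        push_cast
        linarith
    _ = _ := by ring
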